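/- **Theorem (Type Safety for RefLL).** Let $e$ be a closed RefLL expression with $\cdot;\cdot\vdash e:\tau$, and let $e^+$ be its compilation to StackLang. Let $W$ be a world and $\mathsf H$ a heap with $\mathsf H:W$. If $\langle \mathsf H;\cdot;e^+\rangle\to^*\langle \mathsf H';\mathsf S';\mathsf P'\rangle$, then either $\langle \mathsf H';\mathsf S';\mathsf P'\rangle\to\langle \mathsf H'';\mathsf S'';\mathsf P''\rangle$ for some $\mathsf H'',\mathsf S'',\mathsf P''$, or $\mathsf P'$ is the empty program and either $\mathsf S'=\mathsf{Fail}\ c$ with $c\in\{\mathrm{Conv},\mathrm{Idx}\}$, or $\mathsf S'$ consists of exactly one value. The notions are the following. *Source languages.* RefHL has types $\mathtt{unit}\mid\mathtt{bool}\mid\tau+\tau\mid\tau\times\tau\mid\tau\to\tau\mid\mathtt{ref}\,\tau$ and expressions $()$, $\mathtt{true}$, $\mathtt{false}$, $x$, $\mathtt{inl}\,e$, $\mathtt{inr}\,e$, $(e,e)$, $\mathtt{fst}\,e$, $\mathtt{snd}\,e$, $\mathtt{if}\,e\,e\,e$, $\lambda x{:}\tau.e$, $e\,e$, $\mathtt{match}\,e\,x\{e\}\,y\{e\}$,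 $\mathtt{ref}\,e$, $!e$, $e:=e$, and the boundary $(\!|e|\!)_\tau$ around a RefLL expression. RefLL has types $\mathtt{int}\mid[\tau]\mid\tau\to\tau\mid\mathtt{ref}\,\tau$ and expressions $n\in\mathbb Z$, $x$, $[e_1,\dots,e_n]$ ($n\ge 0$), $e[e]$, $\lambda x{:}\tau.e$, $e\,e$, $e+e$, $\mathtt{if0}\,e\,e\,e$, $\mathtt{ref}\,e$, $!e$, $e:=e$, and the boundary $(\!|e|\!)_\tau$ around a RefHL expression. The variables of the two languages are disjoint. Typing is the standard simply typed one, with an environment for each language, both carried through boundaries; an assignment has type $\mathtt{unit}$ in RefHL and $\mathtt{int}$ in RefLL. If $\tau_A\sim\tau_B$, then $(\!|e|\!)_{\tau_B}:\tau_B$ when $e:\tau_A$ in RefHL, and $(\!|e|\!)_{\tau_A}:\tau_A$ when $e:\tau_B$ in RefLL. Convertibility is generated by $\mathtt{bool}\sim\mathtt{int}$; $\mathtt{ref}\,\mathtt{bool}\sim\mathtt{ref}\,\mathtt{int}$; $\tau_1+\tau_2\sim[\mathtt{int}]$ if $\tau_1\sim\mathtt{int}$ and $\tau_2\sim\mathtt{int}$;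 $\tau_1\times\tau_2\sim[\tau]$ if $\tau_1\sim\tau$ and $\tau_2\sim\tau$. *StackLang.* Values are integers, thunks of programs, heap locations and finite arrays of values. A program is a list of instructions $\mathsf{push}\,v$, $\mathsf{add}$, $\mathsf{less?}$, $\mathsf{if0}\,P\,P$, $\mathsf{lam}\,x.P$, $\mathsf{call}$, $\mathsf{idx}$, $\mathsf{len}$, $\mathsf{alloc}$, $\mathsf{read}$, $\mathsf{write}$, $\mathsf{fail}\,c$ with $c\in\{\mathrm{Type},\mathrm{Idx},\mathrm{Conv}\}$; variables bound by $\mathsf{lam}$ may occur in pushed operands. Heaps $\mathsf H$ are finite maps from locations to values; a stack is a list of values (top on the right) or $\mathsf{Fail}\ c$. The steps are $$\begin{array}{ll} \langle \mathsf H;\mathsf S;\mathsf{push}\,v,P\rangle\to\langle \mathsf H;\mathsf S,v;P\rangle & (\mathsf S\ne\mathsf{Fail}\ c)\\ \langle \mathsf H;\mathsf S,n',n;\mathsf{add},P\rangle\to\langle \mathsf H;\mathsf S,n+n';P\rangle &\\ \langle \mathsf H;\mathsf S,n',n;\mathsf{less?},P\rangle\to\langle \mathsf H;\mathsf S,b;P\rangle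 & (b=0\text{ if }n<n'\text{, else }1)\\ \langle \mathsf H;\mathsf S,n;\mathsf{if0}\,P_1\,P_2,P\rangle\to\langle \mathsf H;\mathsf S;P_i,P\rangle & (i=1\text{ if }n=0\text{, else }2)\\ \langle \mathsf H;\mathsf S,v;\mathsf{lam}\,x.P_1,P_2\rangle\to\langle \mathsf H;\mathsf S;[x\mapsto v]P_1,P_2\rangle &\\ \langle \mathsf H;\mathsf S,\mathsf{thunk}\,P_1;\mathsf{call},P_2\rangle\to\langle \mathsf H;\mathsf S;P_1,P_2\rangle &\\ \langle \mathsf H;\mathsf S,[v_0,\dots,v_{m-1}],n;\mathsf{idx},P\rangle\to\langle \mathsf H;\mathsf S,v_n;P\rangle & (0\le n<m)\\ \langle \mathsf H;\mathsf S,[v_0,\dots,v_{m-1}],n;\mathsf{idx},P\rangle\to\langle \mathsf H;\mathsf S;\mathsf{fail}\,\mathrm{Idx}\rangle & (\text{otherwise})\\ \langle \mathsf H;\mathsf S,[v_0,\dots,v_{m-1}];\mathsf{len},P\rangle\to\langle \mathsf H;\mathsf S,m;P\rangle &\\ \langle \mathsf H;\mathsf S,v;\mathsf{alloc},P\rangle\to\langle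 \mathsf H\uplus\{\ell:v\};\mathsf S,\ell;P\rangle & (\ell\notin\mathrm{dom}\,\mathsf H)\\ \langle \mathsf H;\mathsf S,\ell;\mathsf{read},P\rangle\to\langle \mathsf H;\mathsf S,\mathsf H(\ell);P\rangle & (\ell\in\mathrm{dom}\,\mathsf H)\\ \langle \mathsf H;\mathsf S,\ell,v;\mathsf{write},P\rangle\to\langle \mathsf H[\ell\mapsto v];\mathsf S;P\rangle & (\ell\in\mathrm{dom}\,\mathsf H)\\ \langle \mathsf H;\mathsf S;\mathsf{fail}\,c,P\rangle\to\langle \mathsf H;\mathsf{Fail}\ c;\cdot\rangle & \end{array}$$ and $\langle \mathsf H;\mathsf S;i,P\rangle\to\langle \mathsf H;\mathsf S;\mathsf{fail}\,\mathrm{Type}\rangle$ whenever $\mathsf S$ does not have the shape that the rules above require for the instruction $i$. Nothing else steps; in particular, an access to a location outside the heap and a push of an unbound variable are stuck. *Compilers and glue code.* Write $\mathsf{SWAP}=\mathsf{lam}\,x.(\mathsf{lam}\,y.\,\mathsf{push}\,x,\mathsf{push}\,y)$, $\mathsf{DUP}=\mathsf{lam}\,x.(\mathsf{push}\,x,\mathsf{push}\,x)$,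 and $\mathsf{PAIR}=\mathsf{lam}\,x_2.\mathsf{lam}\,x_1.\mathsf{push}\,[x_1,x_2]$. In both languages $x^+=\mathsf{push}\,x$; $(\lambda x{:}\tau.e)^+=\mathsf{push}\,(\mathsf{thunk}\ \mathsf{lam}\,x.e^+)$; $(e_1\,e_2)^+=e_1^+,e_2^+,\mathsf{SWAP},\mathsf{call}$; $(\mathtt{ref}\,e)^+=e^+,\mathsf{alloc}$; $(!e)^+=e^+,\mathsf{read}$; $(e_1:=e_2)^+=e_1^+,e_2^+,\mathsf{write},\mathsf{push}\,0$. In RefLL, $n^+=\mathsf{push}\,n$; $(e_1+e_2)^+=e_1^+,e_2^+,\mathsf{SWAP},\mathsf{add}$; $(\mathtt{if0}\,e\,e_1\,e_2)^+=e^+,\mathsf{if0}\,e_1^+\,e_2^+$; $[e_1,\dots,e_n]^+=e_1^+,\dots,e_n^+,\mathsf{lam}\,x_n.\cdots\mathsf{lam}\,x_1.\,\mathsf{push}\,[x_1,\dots,x_n]$; $(e_1[e_2])^+=e_1^+,e_2^+,\mathsf{idx}$. In RefHL, $()^+=\mathtt{true}^+=\mathsf{push}\,0$; $\mathtt{false}^+=\mathsf{push}\,1$;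 $(\mathtt{inl}\,e)^+$ and $(\mathtt{inr}\,e)^+$ are $e^+,\mathsf{lam}\,x.\,\mathsf{push}\,[t,x]$ with $t=0$ and $t=1$; $(\mathtt{if}\,e\,e_1\,e_2)^+=e^+,\mathsf{if0}\,e_1^+\,e_2^+$; $(e_1,e_2)^+=e_1^+,e_2^+,\mathsf{PAIR}$; $(\mathtt{fst}\,e)^+$ and $(\mathtt{snd}\,e)^+$ are $e^+,\mathsf{push}\,i,\mathsf{idx}$ with $i=0$ and $i=1$; $(\mathtt{match}\,e\,x\{e_1\}\,y\{e_2\})^+=e^+,\mathsf{DUP},\mathsf{push}\,1,\mathsf{idx},\mathsf{SWAP},\mathsf{push}\,0,\mathsf{idx},\mathsf{if0}\,(\mathsf{lam}\,x.e_1^+)\,(\mathsf{lam}\,y.e_2^+)$. A boundary compiles to $e^+,C_{\tau_A\mapsto\tau_B}$ (RefHL code inside RefLL) or $e^+,C_{\tau_B\mapsto\tau_A}$ (RefLL code inside RefHL), where $\tau_A\sim\tau_B$ are the types in the typing derivation; thus $e^+$ is determined by a typing derivation of $e$, and the theorem is claimed for every derivation. All glue code for $\mathtt{bool}\sim\mathtt{int}$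 and $\mathtt{ref}\,\mathtt{bool}\sim\mathtt{ref}\,\mathtt{int}$ is empty. With $\mathsf{CHECK}=\mathsf{DUP},\mathsf{len},\mathsf{push}\,2,\mathsf{SWAP},\mathsf{less?},\mathsf{if0}\,(\mathsf{fail}\,\mathrm{Conv})\,(\cdot)$ and $\mathsf{SPLIT}=\mathsf{DUP},\mathsf{push}\,1,\mathsf{idx},\mathsf{SWAP},\mathsf{push}\,0,\mathsf{idx},\mathsf{DUP}$, $$\begin{aligned} C_{\tau_1+\tau_2\mapsto[\mathtt{int}]}&=\mathsf{SPLIT},\ \mathsf{if0}\,(\mathsf{SWAP},C_{\tau_1\mapsto\mathtt{int}})\,(\mathsf{SWAP},C_{\tau_2\mapsto\mathtt{int}}),\ \mathsf{PAIR}\\ C_{[\mathtt{int}]\mapsto\tau_1+\tau_2}&=\mathsf{CHECK},\mathsf{SPLIT},\ \mathsf{if0}\,(\mathsf{SWAP},C_{\mathtt{int}\mapsto\tau_1})\,\bigl(\mathsf{DUP},\mathsf{push}\,{-1},\mathsf{add},\mathsf{if0}\,(\mathsf{SWAP},C_{\mathtt{int}\mapsto\tau_2})\,(\mathsf{fail}\,\mathrm{Conv})\bigr),\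 \mathsf{PAIR}\\ C_{\tau_1\times\tau_2\mapsto[\tau]}&=\mathsf{DUP},\mathsf{push}\,0,\mathsf{idx},C_{\tau_1\mapsto\tau},\mathsf{SWAP},\mathsf{push}\,1,\mathsf{idx},C_{\tau_2\mapsto\tau},\mathsf{PAIR}\\ C_{[\tau]\mapsto\tau_1\times\tau_2}&=\mathsf{CHECK},\mathsf{DUP},\mathsf{push}\,0,\mathsf{idx},C_{\tau\mapsto\tau_1},\mathsf{SWAP},\mathsf{push}\,1,\mathsf{idx},C_{\tau\mapsto\tau_2},\mathsf{PAIR} \end{aligned}$$ *Worlds.* By recursion on $n$: $\mathit{World}_n$ is the set of pairs $(k,\Psi)$ with $k<n$ and $\Psi$ a finite partial map from locations to $\mathit{Typ}_k$; $\mathit{Typ}_n$ is the set of all sets $R$ of pairs (world in $\mathit{World}_n$, value) such that $(W,v)\in R$ and $W\sqsubseteq W'\in\mathit{World}_n$ imply $(W',v)\in R$. Here $\lfloor R\rfloor_j$ is the restriction of $R$ to worlds in $\mathit{World}_j$, and $(k,\Psi)\sqsubseteq(j,\Psi')$ means $j\le k$ and $\Psi'(\ell)=\lfloor\Psi(\ell)\rfloor_j$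 for all $\ell\in\mathrm{dom}\,\Psi$. For $W=(k,\Psi)$, $\mathsf H:W$ means that every $\ell\in\mathrm{dom}\,\Psi$ lies in $\mathrm{dom}\,\mathsf H$ and $\bigl((j,\lfloor\Psi\rfloor_j),\mathsf H(\ell)\bigr)\in\Psi(\ell)$ for all $j<k$. A world is an element of $\mathit{World}_n$ for some $n$. -/

import Mathlib

namespace RefInterop

/-! ## The two source languages -/

/-- Source variables. The two source languages use separate supplies of variables, each of them
indexed by this type. -/
abbrev Name := ℕ

/-- Types of RefHL. -/
inductive HLTy where
  | unit
  | bool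
  | sum (a b : HLTy)
  | prod (a b : HLTy)
  | fn (a b : HLTy)
  | ref (a : HLTy)

/-- Types of RefLL. -/
inductive LLTy where
  | int
  | arr (a : LLTy)
  | fn (a b : LLTy)
  | ref (a : LLTy)

mutual

/-- Expressions of RefHL. `boundary τ e` is the RefLL expression `e` used at the RefHL type `τ`. -/
inductive HLExpr where
  | unit
  | tt
  | ff
  | var (x : Name)
  | inl (e : HLExpr)
  | inr (e : HLExpr)
  | pair (e₁ e₂ : HLExpr)
  | fst (e : HLExpr)
  | snd (e : HLExpr)
  | ite (e e₁ e₂ : HLExpr)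
  | lam (x : Name) (τ : HLTy) (e : HLExpr)
  | app (e₁ e₂ : HLExpr)
  | matchSum (e : HLExpr) (x : Name) (e₁ : HLExpr) (y : Name) (e₂ : HLExpr)
  | ref (e : HLExpr)
  | deref (e : HLExpr)
  | assign (e₁ e₂ : HLExpr)
  | boundary (τ : HLTy) (e : LLExpr)

/-- Expressions of RefLL. `boundary τ e` is the RefHL expression `e` used at the RefLL type `τ`. -/
inductive LLExpr where
  | int (n : ℤ)
  | var (x : Name)
  | arr (es : List LLExpr)
  | idx (e₁ e₂ : LLExpr)
  | lam (x : Name) (τ : LLTy) (e : LLExpr)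
  | app (e₁ e₂ : LLExpr)
  | add (e₁ e₂ : LLExpr)
  | if0 (e e₁ e₂ : LLExpr)
  | ref (e : LLExpr)
  | deref (e : LLExpr)
  | assign (e₁ e₂ : LLExpr)
  | boundary (τ : LLTy) (e : HLExpr)

end

/-! ## The target language StackLang -/

/-- Target variables: those that come from RefHL, those that come from RefLL, and auxiliary ones
that occur in code inserted by the compilers. The three kinds never clash. -/
inductive TVar where
  | hl (x : Name)
  | ll (x : Name)
  | aux (i : ℕ)
  deriving DecidableEq

/-- Heap locations. -/
abbrev Loc := ℕ

/-- Error codes. -/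
inductive ErrCode where
  | typ
  | idx
  | conv

mutual

/-- Operands of `push`. The constructor `var` is an occurrence of a variable bound by a `lam`
instruction; the values proper are singled out by `Val.IsValue`. A program is a list of
instructions. -/
inductive Val where
  | num (n : ℤ)
  | thunk (P : List Instr)
  | loc (l : Loc)
  | arr (vs : List Val)
  | var (x : TVar)

/-- Instructions. -/
inductive Instr where
  | push (v : Val)
  | add
  | less
  | if0 (P₁ P₂ : List Instr)
  | lam (x : TVar) (P : List Instr)
  | call
  | idx
  | len
  | alloc
  | read
  | write
  | fail (c : ErrCode)

end

/-- Programs. -/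
abbrev Prog := List Instr

/-- Values: numbers, thunks, locations, and arrays of values. -/
inductive Val.IsValue : Val → Prop
  | num (n : ℤ) : Val.IsValue (.num n)
  | thunk (P : Prog) : Val.IsValue (.thunk P)
  | loc (l : Loc) : Val.IsValue (.loc l)
  | arr (vs : List Val) : (∀ v ∈ vs, Val.IsValue v) → Val.IsValue (.arr vs)

mutual

/-- Substitution of `w` for the free occurrences of `x` in an operand. It is used only with closed
`w`, so no renaming of bound variables is needed. -/
def Val.subst (x : TVar) (w : Val) : Val → Val
  | .num n => .num n
  | .thunk P => .thunk (Prog.subst x w P)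
  | .loc l => .loc l
  | .arr vs => .arr (Val.substList x w vs)
  | .var y => if y = x then w else .var y

/-- Substitution in a list of operands. -/
def Val.substList (x : TVar) (w : Val) : List Val → List Val
  | [] => []
  | v :: vs => Val.subst x w v :: Val.substList x w vs

/-- Substitution in an instruction. -/
def Instr.subst (x : TVar) (w : Val) : Instr → Instr
  | .push v => .push (Val.subst x w v)
  | .add => .add
  | .less => .less
  | .if0 P₁ P₂ => .if0 (Prog.subst x w P₁) (Prog.subst x w P₂)
  | .lam y P => .lam y (if y = x then P else Prog.subst x w P)
  | .call => .call
  | .idx => .idx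
  | .len => .len
  | .alloc => .alloc
  | .read => .read
  | .write => .write
  | .fail c => .fail c

/-- Substitution `[x ↦ w]P` in a program. -/
def Prog.subst (x : TVar) (w : Val) : List Instr → List Instr
  | [] => []
  | i :: P => Instr.subst x w i :: Prog.subst x w P

end

/-- Heaps: finite partial maps from locations to values. -/
abbrev Heap := Finmap (fun _ : Loc => Val)

/-- Stacks: a list of values whose head is the top of the stack, or the failure `Fail c`. -/
inductive Stack where
  | vals (vs : List Val)
  | fail (c : ErrCode)

/-- Machine configurations: a heap, a stack and a program. -/
structure Config where
  heap : Heap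
  stack : Stack
  prog : Prog

/-- The precondition that an instruction puts on the stack. -/
def Instr.StackOk : Instr → Stack → Prop
  | .push _, S => ∃ vs, S = .vals vs
  | .add, S => ∃ n n' vs, S = .vals (.num n :: .num n' :: vs)
  | .less, S => ∃ n n' vs, S = .vals (.num n :: .num n' :: vs)
  | .if0 _ _, S => ∃ n vs, S = .vals (.num n :: vs)
  | .lam _ _, S => ∃ v vs, S = .vals (v :: vs)
  | .call, S => ∃ P vs, S = .vals (.thunk P :: vs)
  | .idx, S => ∃ n ws vs, S = .vals (.num n :: .arr ws :: vs)
  | .len, S => ∃ ws vs, S = .vals (.arr ws :: vs)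
  | .alloc, S => ∃ v vs, S = .vals (v :: vs)
  | .read, S => ∃ l vs, S = .vals (.loc l :: vs)
  | .write, S => ∃ v l vs, S = .vals (v :: .loc l :: vs)
  | .fail _, _ => True

/-- The small-step operational semantics. An access to a location outside the heap and a `push` of
something that is not a value (such as an unbound variable) have no step. -/
inductive Step : Config → Config → Prop
  | push (H : Heap) (S : List Val) (v : Val) (P : Prog) : v.IsValue →
      Step ⟨H, .vals S, .push v :: P⟩ ⟨H, .vals (v :: S), P⟩
  | add (H : Heap) (S : List Val) (n n' : ℤ) (P : Prog) :
      Step ⟨H, .vals (.num n :: .num n' :: S), .add :: P⟩ ⟨H, .vals (.num (n + n') :: S), P⟩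
  | less (H : Heap) (S : List Val) (n n' : ℤ) (P : Prog) :
      Step ⟨H, .vals (.num n :: .num n' :: S), .less :: P⟩
        ⟨H, .vals (.num (if n < n' then 0 else 1) :: S), P⟩
  | if0 (H : Heap) (S : List Val) (n : ℤ) (P₁ P₂ P : Prog) :
      Step ⟨H, .vals (.num n :: S), .if0 P₁ P₂ :: P⟩
        ⟨H, .vals S, (if n = 0 then P₁ else P₂) ++ P⟩
  | lam (H : Heap) (S : List Val) (v : Val) (x : TVar) (P₁ P₂ : Prog) :
      Step ⟨H, .vals (v :: S), .lam x P₁ :: P₂⟩ ⟨H, .vals S, Prog.subst x v P₁ ++ P₂⟩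
  | call (H : Heap) (S : List Val) (P₁ P₂ : Prog) :
      Step ⟨H, .vals (.thunk P₁ :: S), .call :: P₂⟩ ⟨H, .vals S, P₁ ++ P₂⟩
  | idx (H : Heap) (S ws : List Val) (i : ℕ) (v : Val) (P : Prog) : ws[i]? = some v →
      Step ⟨H, .vals (.num (i : ℤ) :: .arr ws :: S), .idx :: P⟩ ⟨H, .vals (v :: S), P⟩
  | idxErr (H : Heap) (S ws : List Val) (n : ℤ) (P : Prog) : ¬ (0 ≤ n ∧ n < (ws.length : ℤ)) →
      Step ⟨H, .vals (.num n :: .arr ws :: S), .idx :: P⟩ ⟨H, .vals S, [.fail .idx]⟩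
  | len (H : Heap) (S ws : List Val) (P : Prog) :
      Step ⟨H, .vals (.arr ws :: S), .len :: P⟩ ⟨H, .vals (.num (ws.length : ℤ) :: S), P⟩
  | alloc (H : Heap) (S : List Val) (v : Val) (l : Loc) (P : Prog) : l ∉ H →
      Step ⟨H, .vals (v :: S), .alloc :: P⟩ ⟨H.insert l v, .vals (.loc l :: S), P⟩
  | read (H : Heap) (S : List Val) (l : Loc) (v : Val) (P : Prog) : H.lookup l = some v →
      Step ⟨H, .vals (.loc l :: S), .read :: P⟩ ⟨H, .vals (v :: S), P⟩
  | write (H : Heap) (S : List Val) (l : Loc) (v : Val) (P : Prog) : l ∈ H →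
      Step ⟨H, .vals (v :: .loc l :: S), .write :: P⟩ ⟨H.insert l v, .vals S, P⟩
  | fail (H : Heap) (S : Stack) (c : ErrCode) (P : Prog) :
      Step ⟨H, S, .fail c :: P⟩ ⟨H, .fail c, []⟩
  | typeErr (H : Heap) (S : Stack) (i : Instr) (P : Prog) : ¬ i.StackOk S →
      Step ⟨H, S, i :: P⟩ ⟨H, S, [.fail .typ]⟩

/-- Reachability in any number of steps. -/
abbrev Steps : Config → Config → Prop := Relation.ReflTransGen Step

/-! ## Convertibility and glue code -/

/-- `lam x.(lam y.push x, push y)` -/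
def swap : Prog := [.lam (.aux 0) [.lam (.aux 1) [.push (.var (.aux 0)), .push (.var (.aux 1))]]]

/-- `lam x.(push x, push x)` -/
def dup : Prog := [.lam (.aux 0) [.push (.var (.aux 0)), .push (.var (.aux 0))]]

/-- `lam x₂.lam x₁.push [x₁, x₂]`: replaces the two topmost values by the array of them. -/
def mkPair : Prog :=
  [.lam (.aux 1) [.lam (.aux 0) [.push (.arr [.var (.aux 0), .var (.aux 1)])]]]

/-- The convertibility judgment `τA ∼ τB` between RefHL and RefLL types. -/
inductive Convertible : HLTy → LLTy → Type
  | bool : Convertible .bool .int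
  | refBool : Convertible (.ref .bool) (.ref .int)
  | sum {τ₁ τ₂ : HLTy} : Convertible τ₁ .int → Convertible τ₂ .int →
      Convertible (.sum τ₁ τ₂) (.arr .int)
  | prod {τ₁ τ₂ : HLTy} {τ : LLTy} : Convertible τ₁ τ → Convertible τ₂ τ →
      Convertible (.prod τ₁ τ₂) (.arr τ)

/-- The glue code from the RefHL type to the RefLL type. -/
def Convertible.toLL : {τA : HLTy} → {τB : LLTy} → Convertible τA τB → Prog
  | _, _, .bool => []
  | _, _, .refBool => []
  | _, _, .sum c₁ c₂ =>
      dup ++ [.push (.num 1), .idx] ++ swap ++ [.push (.num 0), .idx] ++ dup ++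
      [.if0 (swap ++ c₁.toLL) (swap ++ c₂.toLL)] ++ mkPair
  | _, _, .prod c₁ c₂ =>
      dup ++ [.push (.num 0), .idx] ++ c₁.toLL ++ swap ++ [.push (.num 1), .idx] ++ c₂.toLL ++
      mkPair

/-- The glue code from the RefLL type to the RefHL type. -/
def Convertible.toHL : {τA : HLTy} → {τB : LLTy} → Convertible τA τB → Prog
  | _, _, .bool => []
  | _, _, .refBool => []
  | _, _, .sum c₁ c₂ =>
      dup ++ [.len, .push (.num 2)] ++ swap ++ [.less, .if0 [.fail .conv] []] ++
      dup ++ [.push (.num 1), .idx] ++ swap ++ [.push (.num 0), .idx] ++ dup ++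
      [.if0 (swap ++ c₁.toHL)
        (dup ++ [.push (.num (-1)), .add, .if0 (swap ++ c₂.toHL) [.fail .conv]])] ++ mkPair
  | _, _, .prod c₁ c₂ =>
      dup ++ [.len, .push (.num 2)] ++ swap ++ [.less, .if0 [.fail .conv] []] ++
      dup ++ [.push (.num 0), .idx] ++ c₁.toHL ++ swap ++ [.push (.num 1), .idx] ++ c₂.toHL ++
      mkPair

/-! ## Static semantics -/

/-- RefHL type environments. -/
abbrev HLCtx := Name → Option HLTy

/-- RefLL type environments. -/
abbrev LLCtx := Name → Option LLTy

/-- The empty RefHL environment. -/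
def HLCtx.empty : HLCtx := fun _ => none

/-- The empty RefLL environment. -/
def LLCtx.empty : LLCtx := fun _ => none

/-- The environment `Γ, x : τ`. -/
def HLCtx.extend (Γ : HLCtx) (x : Name) (τ : HLTy) : HLCtx := Function.update Γ x (some τ)

/-- The environment `Γ, x : τ`. -/
def LLCtx.extend (Γ : LLCtx) (x : Name) (τ : LLTy) : LLCtx := Function.update Γ x (some τ)

mutual

/-- Derivations of the RefHL typing judgment `Δ; Γ ⊢ e : τ`, where `Δ` is the RefLL environment and
`Γ` the RefHL environment. -/
inductive HLDeriv : LLCtx → HLCtx → HLExpr → HLTy → Type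
  | unit {Δ : LLCtx} {Γ : HLCtx} : HLDeriv Δ Γ .unit .unit
  | tt {Δ : LLCtx} {Γ : HLCtx} : HLDeriv Δ Γ .tt .bool
  | ff {Δ : LLCtx} {Γ : HLCtx} : HLDeriv Δ Γ .ff .bool
  | var {Δ : LLCtx} {Γ : HLCtx} {x : Name} {τ : HLTy} : Γ x = some τ → HLDeriv Δ Γ (.var x) τ
  | inl {Δ : LLCtx} {Γ : HLCtx} {e : HLExpr} {τ₁ τ₂ : HLTy} :
      HLDeriv Δ Γ e τ₁ → HLDeriv Δ Γ (.inl e) (.sum τ₁ τ₂)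
  | inr {Δ : LLCtx} {Γ : HLCtx} {e : HLExpr} {τ₁ τ₂ : HLTy} :
      HLDeriv Δ Γ e τ₂ → HLDeriv Δ Γ (.inr e) (.sum τ₁ τ₂)
  | pair {Δ : LLCtx} {Γ : HLCtx} {e₁ e₂ : HLExpr} {τ₁ τ₂ : HLTy} :
      HLDeriv Δ Γ e₁ τ₁ → HLDeriv Δ Γ e₂ τ₂ → HLDeriv Δ Γ (.pair e₁ e₂) (.prod τ₁ τ₂)
  | fst {Δ : LLCtx} {Γ : HLCtx} {e : HLExpr} {τ₁ τ₂ : HLTy} :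
      HLDeriv Δ Γ e (.prod τ₁ τ₂) → HLDeriv Δ Γ (.fst e) τ₁
  | snd {Δ : LLCtx} {Γ : HLCtx} {e : HLExpr} {τ₁ τ₂ : HLTy} :
      HLDeriv Δ Γ e (.prod τ₁ τ₂) → HLDeriv Δ Γ (.snd e) τ₂
  | ite {Δ : LLCtx} {Γ : HLCtx} {e e₁ e₂ : HLExpr} {τ : HLTy} :
      HLDeriv Δ Γ e .bool → HLDeriv Δ Γ e₁ τ → HLDeriv Δ Γ e₂ τ → HLDeriv Δ Γ (.ite e e₁ e₂) τ
  | lam {Δ : LLCtx} {Γ : HLCtx} {x : Name} {e : HLExpr} {τ₁ τ₂ : HLTy} :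
      HLDeriv Δ (Γ.extend x τ₁) e τ₂ → HLDeriv Δ Γ (.lam x τ₁ e) (.fn τ₁ τ₂)
  | app {Δ : LLCtx} {Γ : HLCtx} {e₁ e₂ : HLExpr} {τ₁ τ₂ : HLTy} :
      HLDeriv Δ Γ e₁ (.fn τ₁ τ₂) → HLDeriv Δ Γ e₂ τ₁ → HLDeriv Δ Γ (.app e₁ e₂) τ₂
  | matchSum {Δ : LLCtx} {Γ : HLCtx} {e : HLExpr} {x : Name} {e₁ : HLExpr} {y : Name}
      {e₂ : HLExpr} {τ₁ τ₂ τ : HLTy} :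
      HLDeriv Δ Γ e (.sum τ₁ τ₂) → HLDeriv Δ (Γ.extend x τ₁) e₁ τ →
      HLDeriv Δ (Γ.extend y τ₂) e₂ τ → HLDeriv Δ Γ (.matchSum e x e₁ y e₂) τ
  | ref {Δ : LLCtx} {Γ : HLCtx} {e : HLExpr} {τ : HLTy} :
      HLDeriv Δ Γ e τ → HLDeriv Δ Γ (.ref e) (.ref τ)
  | deref {Δ : LLCtx} {Γ : HLCtx} {e : HLExpr} {τ : HLTy} :
      HLDeriv Δ Γ e (.ref τ) → HLDeriv Δ Γ (.deref e) τ
  | assign {Δ : LLCtx} {Γ : HLCtx} {e₁ e₂ : HLExpr} {τ : HLTy} :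
      HLDeriv Δ Γ e₁ (.ref τ) → HLDeriv Δ Γ e₂ τ → HLDeriv Δ Γ (.assign e₁ e₂) .unit
  | boundary {Δ : LLCtx} {Γ : HLCtx} {e : LLExpr} {τA : HLTy} {τB : LLTy} :
      LLDeriv Γ Δ e τB → Convertible τA τB → HLDeriv Δ Γ (.boundary τA e) τA

/-- Derivations of the RefLL typing judgment `Γ; Δ ⊢ e : τ`, where `Γ` is the RefHL environment and
`Δ` the RefLL environment. -/
inductive LLDeriv : HLCtx → LLCtx → LLExpr → LLTy → Type
  | int {Γ : HLCtx} {Δ : LLCtx} {n : ℤ} : LLDeriv Γ Δ (.int n) .int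
  | var {Γ : HLCtx} {Δ : LLCtx} {x : Name} {τ : LLTy} : Δ x = some τ → LLDeriv Γ Δ (.var x) τ
  | arr {Γ : HLCtx} {Δ : LLCtx} {es : List LLExpr} {τ : LLTy} :
      LLDerivs Γ Δ es τ → LLDeriv Γ Δ (.arr es) (.arr τ)
  | idx {Γ : HLCtx} {Δ : LLCtx} {e₁ e₂ : LLExpr} {τ : LLTy} :
      LLDeriv Γ Δ e₁ (.arr τ) → LLDeriv Γ Δ e₂ .int → LLDeriv Γ Δ (.idx e₁ e₂) τ
  | lam {Γ : HLCtx} {Δ : LLCtx} {x : Name} {e : LLExpr} {τ₁ τ₂ : LLTy} :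
      LLDeriv Γ (Δ.extend x τ₁) e τ₂ → LLDeriv Γ Δ (.lam x τ₁ e) (.fn τ₁ τ₂)
  | app {Γ : HLCtx} {Δ : LLCtx} {e₁ e₂ : LLExpr} {τ₁ τ₂ : LLTy} :
      LLDeriv Γ Δ e₁ (.fn τ₁ τ₂) → LLDeriv Γ Δ e₂ τ₁ → LLDeriv Γ Δ (.app e₁ e₂) τ₂
  | add {Γ : HLCtx} {Δ : LLCtx} {e₁ e₂ : LLExpr} :
      LLDeriv Γ Δ e₁ .int → LLDeriv Γ Δ e₂ .int → LLDeriv Γ Δ (.add e₁ e₂) .int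
  | if0 {Γ : HLCtx} {Δ : LLCtx} {e e₁ e₂ : LLExpr} {τ : LLTy} :
      LLDeriv Γ Δ e .int → LLDeriv Γ Δ e₁ τ → LLDeriv Γ Δ e₂ τ → LLDeriv Γ Δ (.if0 e e₁ e₂) τ
  | ref {Γ : HLCtx} {Δ : LLCtx} {e : LLExpr} {τ : LLTy} :
      LLDeriv Γ Δ e τ → LLDeriv Γ Δ (.ref e) (.ref τ)
  | deref {Γ : HLCtx} {Δ : LLCtx} {e : LLExpr} {τ : LLTy} :
      LLDeriv Γ Δ e (.ref τ) → LLDeriv Γ Δ (.deref e) τ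
  | assign {Γ : HLCtx} {Δ : LLCtx} {e₁ e₂ : LLExpr} {τ : LLTy} :
      LLDeriv Γ Δ e₁ (.ref τ) → LLDeriv Γ Δ e₂ τ → LLDeriv Γ Δ (.assign e₁ e₂) .int
  | boundary {Γ : HLCtx} {Δ : LLCtx} {e : HLExpr} {τA : HLTy} {τB : LLTy} :
      HLDeriv Δ Γ e τA → Convertible τA τB → LLDeriv Γ Δ (.boundary τB e) τB

/-- Derivations that all the elements of an array literal have type `τ`. -/
inductive LLDerivs : HLCtx → LLCtx → List LLExpr → LLTy → Type
  | nil {Γ : HLCtx} {Δ : LLCtx} {τ : LLTy} : LLDerivs Γ Δ [] τ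
  | cons {Γ : HLCtx} {Δ : LLCtx} {e : LLExpr} {es : List LLExpr} {τ : LLTy} :
      LLDeriv Γ Δ e τ → LLDerivs Γ Δ es τ → LLDerivs Γ Δ (e :: es) τ

end

/-! ## The compilers

The glue code at a boundary depends on the types on both sides, of which the syntax records only
one, so the compilers read it off the typing derivation. -/

/-- `lam xₙ₋₁. … lam x₀. P` -/
def bindAux : ℕ → Prog → Prog
  | 0, P => P
  | n + 1, P => [.lam (.aux n) (bindAux n P)]

/-- `lam xₙ₋₁. … lam x₀. push [x₀, …, xₙ₋₁]` -/
def mkArr (n : ℕ) : Prog :=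
  bindAux n [.push (.arr ((List.range n).map fun i => .var (.aux i)))]

mutual

/-- The compiler for RefHL. -/
def HLDeriv.compile : {Δ : LLCtx} → {Γ : HLCtx} → {e : HLExpr} → {τ : HLTy} →
    HLDeriv Δ Γ e τ → Prog
  | _, _, _, _, .unit => [.push (.num 0)]
  | _, _, _, _, .tt => [.push (.num 0)]
  | _, _, _, _, .ff => [.push (.num 1)]
  | _, _, _, _, .var (x := x) _ => [.push (.var (.hl x))]
  | _, _, _, _, .inl d =>
      d.compile ++ [.lam (.aux 0) [.push (.arr [.num 0, .var (.aux 0)])]]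
  | _, _, _, _, .inr d =>
      d.compile ++ [.lam (.aux 0) [.push (.arr [.num 1, .var (.aux 0)])]]
  | _, _, _, _, .pair d₁ d₂ => d₁.compile ++ d₂.compile ++ mkPair
  | _, _, _, _, .fst d => d.compile ++ [.push (.num 0), .idx]
  | _, _, _, _, .snd d => d.compile ++ [.push (.num 1), .idx]
  | _, _, _, _, .ite d d₁ d₂ => d.compile ++ [.if0 d₁.compile d₂.compile]
  | _, _, _, _, .lam (x := x) d => [.push (.thunk [.lam (.hl x) d.compile])]
  | _, _, _, _, .app d₁ d₂ => d₁.compile ++ d₂.compile ++ swap ++ [.call]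
  | _, _, _, _, .matchSum (x := x) (y := y) d d₁ d₂ =>
      d.compile ++ dup ++ [.push (.num 1), .idx] ++ swap ++ [.push (.num 0), .idx,
        .if0 [.lam (.hl x) d₁.compile] [.lam (.hl y) d₂.compile]]
  | _, _, _, _, .ref d => d.compile ++ [.alloc]
  | _, _, _, _, .deref d => d.compile ++ [.read]
  | _, _, _, _, .assign d₁ d₂ => d₁.compile ++ d₂.compile ++ [.write, .push (.num 0)]
  | _, _, _, _, .boundary d c => d.compile ++ c.toHL

/-- The compiler for RefLL. -/
def LLDeriv.compile : {Γ : HLCtx} → {Δ : LLCtx} → {e : LLExpr} → {τ : LLTy} →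
    LLDeriv Γ Δ e τ → Prog
  | _, _, _, _, .int (n := n) => [.push (.num n)]
  | _, _, _, _, .var (x := x) _ => [.push (.var (.ll x))]
  | _, _, _, _, .arr (es := es) ds => ds.compile ++ mkArr es.length
  | _, _, _, _, .idx d₁ d₂ => d₁.compile ++ d₂.compile ++ [.idx]
  | _, _, _, _, .lam (x := x) d => [.push (.thunk [.lam (.ll x) d.compile])]
  | _, _, _, _, .app d₁ d₂ => d₁.compile ++ d₂.compile ++ swap ++ [.call]
  | _, _, _, _, .add d₁ d₂ => d₁.compile ++ d₂.compile ++ swap ++ [.add]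
  | _, _, _, _, .if0 d d₁ d₂ => d.compile ++ [.if0 d₁.compile d₂.compile]
  | _, _, _, _, .ref d => d.compile ++ [.alloc]
  | _, _, _, _, .deref d => d.compile ++ [.read]
  | _, _, _, _, .assign d₁ d₂ => d₁.compile ++ d₂.compile ++ [.write, .push (.num 0)]
  | _, _, _, _, .boundary d c => d.compile ++ c.toLL

/-- The concatenation of the compiled elements of an array literal. -/
def LLDerivs.compile : {Γ : HLCtx} → {Δ : LLCtx} → {es : List LLExpr} → {τ : LLTy} →
    LLDerivs Γ Δ es τ → Prog
  | _, _, _, _, .nil => []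
  | _, _, _, _, .cons d ds => d.compile ++ ds.compile

end

/-! ## Step-indexed worlds

Type interpretations of level `n` are sets of pairs of a world of level `n` and a value; a world of
level `n` consists of a step index `k < n` and a finite partial map from locations to type
interpretations of level `k`. The raw objects come first; the conditions on them follow. -/

/-- Raw type interpretations of level `n`. -/
def PreTyp (n : ℕ) : Type :=
  Set ((Σ k : Fin n, (Loc → Option (PreTyp k.1))) × Val)
termination_by n
decreasing_by exact k.2

/-- Raw worlds of level `n`: a step index `k < n` and a raw heap typing of level `k`. -/
abbrev PreWorld (n : ℕ) : Type := Σ k : Fin n, (Loc → Option (PreTyp k.1))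

theorem preTyp_eq (n : ℕ) : PreTyp n = Set (PreWorld n × Val) := by
  rw [PreTyp]

/-- Raw type interpretations of level `n` are the sets of pairs of a raw world of level `n` and a
value. -/
def PreTyp.equiv (n : ℕ) : PreTyp n ≃ Set (PreWorld n × Val) := Equiv.cast (preTyp_eq n)

/-- The set of pairs that a raw type interpretation is. -/
def PreTyp.atoms {n : ℕ} (R : PreTyp n) : Set (PreWorld n × Val) := PreTyp.equiv n R

/-- A raw world of level `j`, seen as a raw world of a higher level. -/
def PreWorld.lift {j k : ℕ} (h : j ≤ k) (W : PreWorld j) : PreWorld k := ⟨Fin.castLE h W.1, W.2⟩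

/-- The approximation `⌊R⌋_j`: the restriction of `R` to worlds of level `j`. -/
def PreTyp.floor {j k : ℕ} (h : j ≤ k) (R : PreTyp k) : PreTyp j :=
  (PreTyp.equiv j).symm {p | (PreWorld.lift h p.1, p.2) ∈ R.atoms}

/-- World extension `W ⊑ W'`: the step index may drop, and every location of `W` keeps its type, up
to approximation to the new step index. -/
def PreWorld.Extends {n : ℕ} (W W' : PreWorld n) : Prop :=
  ∃ h : W'.1.1 ≤ W.1.1, ∀ (l : Loc) (R : PreTyp W.1.1),
    W.2 l = some R → W'.2 l = some (R.floor h)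

/-- `R` belongs to `Typ n`: it consists of pairs of a world and a value, and is closed under world
extension. Here worlds are raw worlds whose heap typing is finite and has only values in `Typ k`,
`k` being the step index. -/
def PreTyp.IsTyp (n : ℕ) (R : PreTyp n) : Prop :=
  ∀ p ∈ R.atoms, p.2.IsValue ∧
    ({l | p.1.2 l ≠ none}.Finite ∧
      ∀ (l : Loc) (T : PreTyp p.1.1.1), p.1.2 l = some T → PreTyp.IsTyp p.1.1.1 T) ∧
    ∀ W' : PreWorld n,
      ({l | W'.2 l ≠ none}.Finite ∧
        ∀ (l : Loc) (T : PreTyp W'.1.1), W'.2 l = some T → PreTyp.IsTyp W'.1.1 T) →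
      p.1.Extends W' → (W', p.2) ∈ R.atoms
termination_by n
decreasing_by
  · exact p.1.1.2
  · exact W'.1.2

/-- A raw world is a world if its heap typing is finite and all its entries are in `Typ k`, where
`k` is the step index. -/
def PreWorld.IsWorld {n : ℕ} (W : PreWorld n) : Prop :=
  {l | W.2 l ≠ none}.Finite ∧
    ∀ (l : Loc) (T : PreTyp W.1.1), W.2 l = some T → PreTyp.IsTyp W.1.1 T

/-- Worlds of level `n`. -/
abbrev World (n : ℕ) : Type := {W : PreWorld n // W.IsWorld}

/-- The approximation of a raw world to a smaller step index `j`, at the level `k` of the type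
interpretations in its heap typing. -/
def PreWorld.approx {n : ℕ} (W : PreWorld n) (j : ℕ) (h : j < W.1.1) : PreWorld W.1.1 :=
  ⟨⟨j, h⟩, fun l => (W.2 l).map (PreTyp.floor h.le)⟩

/-- The heap `H` satisfies the world `W`, written `H : W`: every location of the heap typing is in
the heap, and its contents belong to the type recorded for it at all smaller step indices. -/
def Heap.Satisfies {n : ℕ} (H : Heap) (W : World n) : Prop :=
  ∀ (l : Loc) (R : PreTyp W.1.1.1), W.1.2 l = some R →
    ∃ v : Val, H.lookup l = some v ∧
      ∀ (j : ℕ) (h : j < W.1.1.1), (W.1.approx j h, v) ∈ R.atoms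

end RefInterop

open RefInterop

namespace RefInterop

/-! ## Simultaneous substitution -/

mutual

/-- Simultaneous substitution in an operand. -/
def Val.msubst : (TVar → Val) → Val → Val
  | _, .num n => .num n
  | σ, .thunk P => .thunk (Prog.msubst σ P)
  | _, .loc l => .loc l
  | σ, .arr vs => .arr (Val.msubstList σ vs)
  | σ, .var y => σ y

/-- Simultaneous substitution in a list of operands. -/
def Val.msubstList : (TVar → Val) → List Val → List Val
  | _, [] => []
  | σ, v :: vs => Val.msubst σ v :: Val.msubstList σ vs

/-- Simultaneous substitution in an instruction. -/
def Instr.msubst : (TVar → Val) → Instr → Instr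
  | σ, .push v => .push (Val.msubst σ v)
  | _, .add => .add
  | _, .less => .less
  | σ, .if0 P₁ P₂ => .if0 (Prog.msubst σ P₁) (Prog.msubst σ P₂)
  | σ, .lam y P => .lam y (Prog.msubst (Function.update σ y (.var y)) P)
  | _, .call => .call
  | _, .idx => .idx
  | _, .len => .len
  | _, .alloc => .alloc
  | _, .read => .read
  | _, .write => .write
  | _, .fail c => .fail c

/-- Simultaneous substitution in a program. -/
def Prog.msubst : (TVar → Val) → List Instr → List Instr
  | _, [] => []
  | σ, i :: P => Instr.msubst σ i :: Prog.msubst σ P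

end

theorem Prog.msubst_append (σ : TVar → Val) (P Q : Prog) :
    Prog.msubst σ (P ++ Q) = Prog.msubst σ P ++ Prog.msubst σ Q := by
  induction P with
  | nil => simp [Prog.msubst]
  | cons i P ih => simp [Prog.msubst, ih]

theorem Val.msubstList_eq_map (σ : TVar → Val) (vs : List Val) :
    Val.msubstList σ vs = vs.map (Val.msubst σ) := by
  induction vs with
  | nil => simp [Val.msubstList]
  | cons v vs ih => simp [Val.msubstList, ih]

mutual

theorem Val.msubst_var : ∀ v : Val, Val.msubst Val.var v = v
  | .num _ => by simp [Val.msubst]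
  | .thunk P => by simp [Val.msubst, Prog.msubst_var P]
  | .loc _ => by simp [Val.msubst]
  | .arr vs => by simp [Val.msubst, Val.msubstList_var vs]
  | .var _ => by simp [Val.msubst]

theorem Val.msubstList_var : ∀ vs : List Val, Val.msubstList Val.var vs = vs
  | [] => by simp [Val.msubstList]
  | v :: vs => by simp [Val.msubstList, Val.msubst_var v, Val.msubstList_var vs]

theorem Instr.msubst_var : ∀ i : Instr, Instr.msubst Val.var i = i
  | .push v => by simp [Instr.msubst, Val.msubst_var v]
  | .add => by simp [Instr.msubst]
  | .less => by simp [Instr.msubst]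
  | .if0 P₁ P₂ => by simp [Instr.msubst, Prog.msubst_var P₁, Prog.msubst_var P₂]
  | .lam y P => by simp [Instr.msubst, Prog.msubst_var P]
  | .call => by simp [Instr.msubst]
  | .idx => by simp [Instr.msubst]
  | .len => by simp [Instr.msubst]
  | .alloc => by simp [Instr.msubst]
  | .read => by simp [Instr.msubst]
  | .write => by simp [Instr.msubst]
  | .fail c => by simp [Instr.msubst]

theorem Prog.msubst_var : ∀ P : List Instr, Prog.msubst Val.var P = P
  | [] => by simp [Prog.msubst]
  | i :: P => by simp [Prog.msubst, Instr.msubst_var i, Prog.msubst_var P]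

end

mutual

theorem Val.subst_eq_msubst (x : TVar) (w : Val) :
    ∀ v : Val, Val.subst x w v = Val.msubst (Function.update Val.var x w) v
  | .num _ => by simp [Val.msubst, Val.subst]
  | .thunk P => by simp [Val.msubst, Val.subst, Prog.subst_eq_msubst x w P]
  | .loc _ => by simp [Val.msubst, Val.subst]
  | .arr vs => by simp [Val.msubst, Val.subst, Val.substList_eq_msubstList x w vs]
  | .var y => by simp [Val.msubst, Val.subst, Function.update_apply]

theorem Val.substList_eq_msubstList (x : TVar) (w : Val) :
    ∀ vs : List Val, Val.substList x w vs = Val.msubstList (Function.update Val.var x w) vs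
  | [] => by simp [Val.msubstList, Val.substList]
  | v :: vs => by
    simp [Val.msubstList, Val.substList, Val.subst_eq_msubst x w v,
      Val.substList_eq_msubstList x w vs]

theorem Instr.subst_eq_msubst (x : TVar) (w : Val) :
    ∀ i : Instr, Instr.subst x w i = Instr.msubst (Function.update Val.var x w) i
  | .push v => by simp [Instr.msubst, Instr.subst, Val.subst_eq_msubst x w v]
  | .add => by simp [Instr.msubst, Instr.subst]
  | .less => by simp [Instr.msubst, Instr.subst]
  | .if0 P₁ P₂ => by
    simp [Instr.msubst, Instr.subst, Prog.subst_eq_msubst x w P₁, Prog.subst_eq_msubst x w P₂]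
  | .lam y P => by
    have ih := Prog.subst_eq_msubst x w P
    by_cases h : y = x
    · subst h
      simp [Instr.msubst, Instr.subst, Prog.msubst_var]
    · have : Function.update (Function.update Val.var x w) y (Val.var y) =
          Function.update Val.var x w := by
        rw [Function.update_eq_self_iff, Function.update_of_ne h]
      simp [Instr.msubst, Instr.subst, h, ih, this]
  | .call => by simp [Instr.msubst, Instr.subst]
  | .idx => by simp [Instr.msubst, Instr.subst]
  | .len => by simp [Instr.msubst, Instr.subst]
  | .alloc => by simp [Instr.msubst, Instr.subst]
  | .read => by simp [Instr.msubst, Instr.subst]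
  | .write => by simp [Instr.msubst, Instr.subst]
  | .fail c => by simp [Instr.msubst, Instr.subst]

theorem Prog.subst_eq_msubst (x : TVar) (w : Val) :
    ∀ P : List Instr, Prog.subst x w P = Prog.msubst (Function.update Val.var x w) P
  | [] => by simp [Prog.msubst, Prog.subst]
  | i :: P => by
    simp [Prog.msubst, Prog.subst, Instr.subst_eq_msubst x w i, Prog.subst_eq_msubst x w P]

end

/-- An operand is closed if no substitution changes it. -/
def Val.Closed (v : Val) : Prop := ∀ σ, Val.msubst σ v = v

theorem Val.Closed.subst_eq {v : Val} (hv : v.Closed) (x : TVar) (w : Val) :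
    Val.subst x w v = v := by
  rw [Val.subst_eq_msubst, hv]

/-- A substitution is closing if it sends every variable to itself or to a closed operand. -/
def Closing (σ : TVar → Val) : Prop := ∀ y, σ y = .var y ∨ (σ y).Closed

theorem Closing.update {σ : TVar → Val} (hσ : Closing σ) (x : TVar) {v : Val}
    (hv : v = .var x ∨ v.Closed) : Closing (Function.update σ x v) := by
  intro y
  by_cases h : y = x
  · subst h
    simpa using hv
  · simpa [h] using hσ y

mutual

theorem Val.msubst_msubst (δ σ : TVar → Val) (hσ : Closing σ) :
    ∀ v : Val, Val.msubst δ (Val.msubst σ v) = Val.msubst (fun y => Val.msubst δ (σ y)) v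
  | .num _ => by simp [Val.msubst]
  | .thunk P => by simp [Val.msubst, Prog.msubst_msubst δ σ hσ P]
  | .loc _ => by simp [Val.msubst]
  | .arr vs => by simp [Val.msubst, Val.msubstList_msubstList δ σ hσ vs]
  | .var _ => by simp [Val.msubst]

theorem Val.msubstList_msubstList (δ σ : TVar → Val) (hσ : Closing σ) :
    ∀ vs : List Val, Val.msubstList δ (Val.msubstList σ vs) =
      Val.msubstList (fun y => Val.msubst δ (σ y)) vs
  | [] => by simp [Val.msubstList]
  | v :: vs => by
    simp [Val.msubstList, Val.msubst_msubst δ σ hσ v, Val.msubstList_msubstList δ σ hσ vs]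

theorem Instr.msubst_msubst (δ σ : TVar → Val) (hσ : Closing σ) :
    ∀ i : Instr, Instr.msubst δ (Instr.msubst σ i) = Instr.msubst (fun y => Val.msubst δ (σ y)) i
  | .push v => by simp [Instr.msubst, Val.msubst_msubst δ σ hσ v]
  | .add => by simp [Instr.msubst]
  | .less => by simp [Instr.msubst]
  | .if0 P₁ P₂ => by
    simp [Instr.msubst, Prog.msubst_msubst δ σ hσ P₁, Prog.msubst_msubst δ σ hσ P₂]
  | .lam x P => by
    have ih := Prog.msubst_msubst (Function.update δ x (.var x)) (Function.update σ x (.var x))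
      (hσ.update x (.inl rfl)) P
    have : (fun y => Val.msubst (Function.update δ x (.var x))
          (Function.update σ x (.var x) y)) =
        Function.update (fun y => Val.msubst δ (σ y)) x (.var x) := by
      funext y
      by_cases h : y = x
      · subst h
        simp [Val.msubst]
      · rcases hσ y with hy | hy
        · simp [h, hy, Val.msubst]
        · simp [h, hy _]
    simp [Instr.msubst, ih, this]
  | .call => by simp [Instr.msubst]
  | .idx => by simp [Instr.msubst]
  | .len => by simp [Instr.msubst]
  | .alloc => by simp [Instr.msubst]
  | .read => by simp [Instr.msubst]
  | .write => by simp [Instr.msubst]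
  | .fail c => by simp [Instr.msubst]

theorem Prog.msubst_msubst (δ σ : TVar → Val) (hσ : Closing σ) :
    ∀ P : List Instr, Prog.msubst δ (Prog.msubst σ P) =
      Prog.msubst (fun y => Val.msubst δ (σ y)) P
  | [] => by simp [Prog.msubst]
  | i :: P => by
    simp [Prog.msubst, Instr.msubst_msubst δ σ hσ i, Prog.msubst_msubst δ σ hσ P]

end

theorem Prog.subst_msubst_update {σ : TVar → Val} (hσ : Closing σ) (x : TVar) (w : Val)
    (P : Prog) :
    Prog.subst x w (Prog.msubst (Function.update σ x (.var x)) P) =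
      Prog.msubst (Function.update σ x w) P := by
  rw [Prog.subst_eq_msubst, Prog.msubst_msubst _ _ (hσ.update x (.inl rfl))]
  congr 1
  funext y
  by_cases h : y = x
  · subst h
    simp [Val.msubst]
  · rcases hσ y with hy | hy
    · simp [h, hy, Val.msubst]
    · simp [h, hy _]

/-! ## Free variables of compiled code -/

theorem swap_msubst (σ : TVar → Val) : Prog.msubst σ swap = swap := by
  simp [swap, Prog.msubst, Instr.msubst, Val.msubst]

theorem dup_msubst (σ : TVar → Val) : Prog.msubst σ dup = dup := by
  simp [dup, Prog.msubst, Instr.msubst, Val.msubst]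

theorem mkPair_msubst (σ : TVar → Val) : Prog.msubst σ mkPair = mkPair := by
  simp [mkPair, Prog.msubst, Instr.msubst, Val.msubst, Val.msubstList]

theorem bindAux_msubst_eq_self (P : Prog) : ∀ (n : ℕ) (σ : TVar → Val),
    (∀ δ : TVar → Val, (∀ i < n, δ (.aux i) = .var (.aux i)) →
      (∀ i ≥ n, δ (.aux i) = σ (.aux i)) → Prog.msubst δ P = P) →
    Prog.msubst σ (bindAux n P) = bindAux n P
  | 0, σ, h => h σ (by simp) (by simp)
  | n + 1, σ, h => by
    have := bindAux_msubst_eq_self P n (Function.update σ (.aux n) (.var (.aux n))) (by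
      intro δ h₁ h₂
      refine h δ (fun i hi => ?_) (fun i hi => ?_)
      · rcases Nat.lt_succ_iff_lt_or_eq.1 hi with hi | rfl
        · exact h₁ i hi
        · simpa using h₂ i le_rfl
      · have hne : i ≠ n := by lia
        simpa [hne] using h₂ i (by lia))
    simp [bindAux, Prog.msubst, Instr.msubst, this]

theorem mkArr_msubst (n : ℕ) (σ : TVar → Val) : Prog.msubst σ (mkArr n) = mkArr n := by
  apply bindAux_msubst_eq_self
  intro τ h _
  simp only [Prog.msubst, Instr.msubst, Val.msubst, Val.msubstList_eq_map, List.map_map]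
  congr 3
  apply List.map_congr_left
  intro i hi
  simpa [Val.msubst] using h i (List.mem_range.1 hi)

theorem Convertible.toLL_msubst (σ : TVar → Val) : ∀ {A : HLTy} {B : LLTy}
    (c : Convertible A B), Prog.msubst σ c.toLL = c.toLL
  | _, _, .bool => by simp [Convertible.toLL, Prog.msubst]
  | _, _, .refBool => by simp [Convertible.toLL, Prog.msubst]
  | _, _, .sum c₁ c₂ => by
    simp [Convertible.toLL, Prog.msubst, Prog.msubst_append, Instr.msubst, Val.msubst,
      swap_msubst, dup_msubst, mkPair_msubst, c₁.toLL_msubst σ, c₂.toLL_msubst σ]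
  | _, _, .prod c₁ c₂ => by
    simp [Convertible.toLL, Prog.msubst, Prog.msubst_append, Instr.msubst, Val.msubst,
      swap_msubst, dup_msubst, mkPair_msubst, c₁.toLL_msubst σ, c₂.toLL_msubst σ]

theorem Convertible.toHL_msubst (σ : TVar → Val) : ∀ {A : HLTy} {B : LLTy}
    (c : Convertible A B), Prog.msubst σ c.toHL = c.toHL
  | _, _, .bool => by simp [Convertible.toHL, Prog.msubst]
  | _, _, .refBool => by simp [Convertible.toHL, Prog.msubst]
  | _, _, .sum c₁ c₂ => by
    simp [Convertible.toHL, Prog.msubst, Prog.msubst_append, Instr.msubst, Val.msubst,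
      swap_msubst, dup_msubst, mkPair_msubst, c₁.toHL_msubst σ, c₂.toHL_msubst σ]
  | _, _, .prod c₁ c₂ => by
    simp [Convertible.toHL, Prog.msubst, Prog.msubst_append, Instr.msubst, Val.msubst,
      swap_msubst, dup_msubst, mkPair_msubst, c₁.toHL_msubst σ, c₂.toHL_msubst σ]

/-- Two substitutions agree on the variables declared in a pair of environments. -/
structure AgreeOn (Γ : HLCtx) (Δ : LLCtx) (σ σ' : TVar → Val) : Prop where
  hl : ∀ x, Γ x ≠ none → σ (.hl x) = σ' (.hl x)
  ll : ∀ x, Δ x ≠ none → σ (.ll x) = σ' (.ll x)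

theorem AgreeOn.extendHL {Γ : HLCtx} {Δ : LLCtx} {σ σ' : TVar → Val} (h : AgreeOn Γ Δ σ σ')
    (x : Name) (τ : HLTy) (v : Val) :
    AgreeOn (Γ.extend x τ) Δ (Function.update σ (.hl x) v) (Function.update σ' (.hl x) v) := by
  refine ⟨fun y hy => ?_, fun y hy => by simpa using h.ll y hy⟩
  by_cases hxy : y = x
  · subst hxy
    simp
  · simpa [hxy] using h.hl y (by simpa [HLCtx.extend, hxy] using hy)

theorem AgreeOn.extendLL {Γ : HLCtx} {Δ : LLCtx} {σ σ' : TVar → Val} (h : AgreeOn Γ Δ σ σ')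
    (x : Name) (τ : LLTy) (v : Val) :
    AgreeOn Γ (Δ.extend x τ) (Function.update σ (.ll x) v) (Function.update σ' (.ll x) v) := by
  refine ⟨fun y hy => by simpa using h.hl y hy, fun y hy => ?_⟩
  by_cases hxy : y = x
  · subst hxy
    simp
  · simpa [hxy] using h.ll y (by simpa [LLCtx.extend, hxy] using hy)

mutual

theorem HLDeriv.msubst_congr : ∀ {Δ : LLCtx} {Γ : HLCtx} {e : HLExpr} {τ : HLTy}
    (d : HLDeriv Δ Γ e τ) {σ σ' : TVar → Val}, AgreeOn Γ Δ σ σ' →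
    Prog.msubst σ d.compile = Prog.msubst σ' d.compile
  | _, _, _, _, .unit, _, _, _ => by
    simp [HLDeriv.compile, Prog.msubst, Instr.msubst, Val.msubst]
  | _, _, _, _, .tt, _, _, _ => by
    simp [HLDeriv.compile, Prog.msubst, Instr.msubst, Val.msubst]
  | _, _, _, _, .ff, _, _, _ => by
    simp [HLDeriv.compile, Prog.msubst, Instr.msubst, Val.msubst]
  | _, _, _, _, .var hx, _, _, h => by
    simp [HLDeriv.compile, Prog.msubst, Instr.msubst, Val.msubst,
      h.hl _ (Option.ne_none_iff_exists'.2 ⟨_, hx⟩)]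
  | _, _, _, _, .inl d, _, _, h => by
    simp [HLDeriv.compile, Prog.msubst, Prog.msubst_append, Instr.msubst, Val.msubst,
      Val.msubstList, d.msubst_congr h]
  | _, _, _, _, .inr d, _, _, h => by
    simp [HLDeriv.compile, Prog.msubst, Prog.msubst_append, Instr.msubst, Val.msubst,
      Val.msubstList, d.msubst_congr h]
  | _, _, _, _, .pair d₁ d₂, _, _, h => by
    simp [HLDeriv.compile, Prog.msubst_append, mkPair_msubst, d₁.msubst_congr h,
      d₂.msubst_congr h]
  | _, _, _, _, .fst d, _, _, h => by
    simp [HLDeriv.compile, Prog.msubst, Prog.msubst_append, Instr.msubst, Val.msubst,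
      d.msubst_congr h]
  | _, _, _, _, .snd d, _, _, h => by
    simp [HLDeriv.compile, Prog.msubst, Prog.msubst_append, Instr.msubst, Val.msubst,
      d.msubst_congr h]
  | _, _, _, _, .ite d d₁ d₂, _, _, h => by
    simp [HLDeriv.compile, Prog.msubst, Prog.msubst_append, Instr.msubst,
      d.msubst_congr h, d₁.msubst_congr h, d₂.msubst_congr h]
  | _, _, _, _, .lam (x := x) (τ₁ := τ₁) d, _, _, h => by
    simp [HLDeriv.compile, Prog.msubst, Instr.msubst, Val.msubst,
      d.msubst_congr (h.extendHL x τ₁ (.var (.hl x)))]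
  | _, _, _, _, .app d₁ d₂, _, _, h => by
    simp [HLDeriv.compile, Prog.msubst, Prog.msubst_append, Instr.msubst, swap_msubst,
      d₁.msubst_congr h, d₂.msubst_congr h]
  | _, _, _, _, .matchSum (x := x) (y := y) (τ₁ := τ₁) (τ₂ := τ₂) d d₁ d₂, _, _, h => by
    simp [HLDeriv.compile, Prog.msubst, Prog.msubst_append, Instr.msubst, Val.msubst,
      swap_msubst, dup_msubst, d.msubst_congr h,
      d₁.msubst_congr (h.extendHL x τ₁ (.var (.hl x))),
      d₂.msubst_congr (h.extendHL y τ₂ (.var (.hl y)))]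
  | _, _, _, _, .ref d, _, _, h => by
    simp [HLDeriv.compile, Prog.msubst, Prog.msubst_append, Instr.msubst, d.msubst_congr h]
  | _, _, _, _, .deref d, _, _, h => by
    simp [HLDeriv.compile, Prog.msubst, Prog.msubst_append, Instr.msubst, d.msubst_congr h]
  | _, _, _, _, .assign d₁ d₂, _, _, h => by
    simp [HLDeriv.compile, Prog.msubst, Prog.msubst_append, Instr.msubst, Val.msubst,
      d₁.msubst_congr h, d₂.msubst_congr h]
  | _, _, _, _, .boundary d c, _, _, h => by
    simp [HLDeriv.compile, Prog.msubst_append, d.msubst_congr h, c.toHL_msubst]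

theorem LLDeriv.msubst_congr : ∀ {Γ : HLCtx} {Δ : LLCtx} {e : LLExpr} {τ : LLTy}
    (d : LLDeriv Γ Δ e τ) {σ σ' : TVar → Val}, AgreeOn Γ Δ σ σ' →
    Prog.msubst σ d.compile = Prog.msubst σ' d.compile
  | _, _, _, _, .int, _, _, _ => by
    simp [LLDeriv.compile, Prog.msubst, Instr.msubst, Val.msubst]
  | _, _, _, _, .var hx, _, _, h => by
    simp [LLDeriv.compile, Prog.msubst, Instr.msubst, Val.msubst,
      h.ll _ (Option.ne_none_iff_exists'.2 ⟨_, hx⟩)]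
  | _, _, _, _, .arr ds, _, _, h => by
    simp [LLDeriv.compile, Prog.msubst_append, mkArr_msubst, ds.msubst_congr h]
  | _, _, _, _, .idx d₁ d₂, _, _, h => by
    simp [LLDeriv.compile, Prog.msubst, Prog.msubst_append, Instr.msubst,
      d₁.msubst_congr h, d₂.msubst_congr h]
  | _, _, _, _, .lam (x := x) (τ₁ := τ₁) d, _, _, h => by
    simp [LLDeriv.compile, Prog.msubst, Instr.msubst, Val.msubst,
      d.msubst_congr (h.extendLL x τ₁ (.var (.ll x)))]
  | _, _, _, _, .app d₁ d₂, _, _, h => by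
    simp [LLDeriv.compile, Prog.msubst, Prog.msubst_append, Instr.msubst, swap_msubst,
      d₁.msubst_congr h, d₂.msubst_congr h]
  | _, _, _, _, .add d₁ d₂, _, _, h => by
    simp [LLDeriv.compile, Prog.msubst, Prog.msubst_append, Instr.msubst, swap_msubst,
      d₁.msubst_congr h, d₂.msubst_congr h]
  | _, _, _, _, .if0 d d₁ d₂, _, _, h => by
    simp [LLDeriv.compile, Prog.msubst, Prog.msubst_append, Instr.msubst,
      d.msubst_congr h, d₁.msubst_congr h, d₂.msubst_congr h]
  | _, _, _, _, .ref d, _, _, h => by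
    simp [LLDeriv.compile, Prog.msubst, Prog.msubst_append, Instr.msubst, d.msubst_congr h]
  | _, _, _, _, .deref d, _, _, h => by
    simp [LLDeriv.compile, Prog.msubst, Prog.msubst_append, Instr.msubst, d.msubst_congr h]
  | _, _, _, _, .assign d₁ d₂, _, _, h => by
    simp [LLDeriv.compile, Prog.msubst, Prog.msubst_append, Instr.msubst, Val.msubst,
      d₁.msubst_congr h, d₂.msubst_congr h]
  | _, _, _, _, .boundary d c, _, _, h => by
    simp [LLDeriv.compile, Prog.msubst_append, d.msubst_congr h, c.toLL_msubst]

theorem LLDerivs.msubst_congr : ∀ {Γ : HLCtx} {Δ : LLCtx} {es : List LLExpr} {τ : LLTy}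
    (ds : LLDerivs Γ Δ es τ) {σ σ' : TVar → Val}, AgreeOn Γ Δ σ σ' →
    Prog.msubst σ ds.compile = Prog.msubst σ' ds.compile
  | _, _, _, _, .nil, _, _, _ => by simp [LLDerivs.compile, Prog.msubst]
  | _, _, _, _, .cons d ds, _, _, h => by
    simp [LLDerivs.compile, Prog.msubst_append, d.msubst_congr h, ds.msubst_congr h]

end

/-! ## Value typing -/

/-- Types of target values, shared by the two source languages. -/
inductive Ty where
  | int
  | sum (a b : Ty)
  | prod (a b : Ty)
  | arr (a : Ty)
  | fn (a b : Ty)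
  | ref (a : Ty)

/-- The target type of the values of a RefHL type. -/
def HLTy.ty : HLTy → Ty
  | .unit => .int
  | .bool => .int
  | .sum a b => .sum a.ty b.ty
  | .prod a b => .prod a.ty b.ty
  | .fn a b => .fn a.ty b.ty
  | .ref a => .ref a.ty

/-- The target type of the values of a RefLL type. -/
def LLTy.ty : LLTy → Ty
  | .int => .int
  | .arr a => .arr a.ty
  | .fn a b => .fn a.ty b.ty
  | .ref a => .ref a.ty

/-- Heap typings. -/
abbrev HeapTy := Loc → Option Ty

/-- A substitution is supported on a pair of environments if it fixes all other variables. -/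
structure SupportedOn (Γ : HLCtx) (Δ : LLCtx) (σ : TVar → Val) : Prop where
  hl : ∀ x, Γ x = none → σ (.hl x) = .var (.hl x)
  ll : ∀ x, Δ x = none → σ (.ll x) = .var (.ll x)
  aux : ∀ i, σ (.aux i) = .var (.aux i)

/-- Value typing relative to a heap typing. A thunk has a function type if it is a closure: a
compiled function body with well-typed values for its free variables. -/
inductive HasTy (Ψ : HeapTy) : Val → Ty → Prop
  | num (n : ℤ) : HasTy Ψ (.num n) .int
  | loc {l : Loc} {a : Ty} : Ψ l = some a → HasTy Ψ (.loc l) (.ref a)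
  | inl {v : Val} {a b : Ty} : HasTy Ψ v a → HasTy Ψ (.arr [.num 0, v]) (.sum a b)
  | inr {v : Val} {a b : Ty} : HasTy Ψ v b → HasTy Ψ (.arr [.num 1, v]) (.sum a b)
  | pair {v w : Val} {a b : Ty} : HasTy Ψ v a → HasTy Ψ w b → HasTy Ψ (.arr [v, w]) (.prod a b)
  | arr {vs : List Val} {a : Ty} : (∀ v ∈ vs, HasTy Ψ v a) → HasTy Ψ (.arr vs) (.arr a)
  | hlThunk {Γ : HLCtx} {Δ : LLCtx} {x : Name} {e : HLExpr} {τ₁ τ₂ : HLTy} {σ : TVar → Val}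
      (d : HLDeriv Δ (Γ.extend x τ₁) e τ₂) : SupportedOn Γ Δ σ →
      (∀ y τ, Γ y = some τ → HasTy Ψ (σ (.hl y)) τ.ty) →
      (∀ y τ, Δ y = some τ → HasTy Ψ (σ (.ll y)) τ.ty) →
      HasTy Ψ (.thunk [.lam (.hl x)
        (Prog.msubst (Function.update σ (.hl x) (.var (.hl x))) d.compile)]) (.fn τ₁.ty τ₂.ty)
  | llThunk {Γ : HLCtx} {Δ : LLCtx} {x : Name} {e : LLExpr} {τ₁ τ₂ : LLTy} {σ : TVar → Val}
      (d : LLDeriv Γ (Δ.extend x τ₁) e τ₂) : SupportedOn Γ Δ σ →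
      (∀ y τ, Γ y = some τ → HasTy Ψ (σ (.hl y)) τ.ty) →
      (∀ y τ, Δ y = some τ → HasTy Ψ (σ (.ll y)) τ.ty) →
      HasTy Ψ (.thunk [.lam (.ll x)
        (Prog.msubst (Function.update σ (.ll x) (.var (.ll x))) d.compile)]) (.fn τ₁.ty τ₂.ty)

theorem SupportedOn.closing {Γ : HLCtx} {Δ : LLCtx} {σ : TVar → Val} (h : SupportedOn Γ Δ σ)
    (hl : ∀ y τ, Γ y = some τ → (σ (.hl y)).Closed)
    (ll : ∀ y τ, Δ y = some τ → (σ (.ll y)).Closed) : Closing σ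
  | .hl x => by
    cases hx : Γ x with
    | none => exact .inl (h.hl x hx)
    | some τ => exact .inr (hl x τ hx)
  | .ll x => by
    cases hx : Δ x with
    | none => exact .inl (h.ll x hx)
    | some τ => exact .inr (ll x τ hx)
  | .aux i => .inl (h.aux i)

theorem HasTy.isValue {Ψ : HeapTy} {v : Val} {a : Ty} (h : HasTy Ψ v a) : v.IsValue := by
  induction h with
  | num n => exact .num n
  | loc _ => exact .loc _
  | inl _ ih => exact .arr _ (by simpa using ⟨.num 0, ih⟩)
  | inr _ ih => exact .arr _ (by simpa using ⟨.num 1, ih⟩)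
  | pair _ _ ih₁ ih₂ => exact .arr _ (by simpa using ⟨ih₁, ih₂⟩)
  | arr _ ih => exact .arr _ ih
  | hlThunk => exact .thunk _
  | llThunk => exact .thunk _

theorem HasTy.closed {Ψ : HeapTy} {v : Val} {a : Ty} (h : HasTy Ψ v a) : v.Closed := by
  induction h with
  | num n => intro δ; simp [Val.msubst]
  | loc _ => intro δ; simp [Val.msubst]
  | inl _ ih => intro δ; simp [Val.msubst, Val.msubstList, ih δ]
  | inr _ ih => intro δ; simp [Val.msubst, Val.msubstList, ih δ]
  | pair _ _ ih₁ ih₂ => intro δ; simp [Val.msubst, Val.msubstList, ih₁ δ, ih₂ δ]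
  | @arr vs _ _ ih =>
    intro δ
    simp only [Val.msubst, Val.msubstList_eq_map, Val.arr.injEq]
    conv_rhs => rw [← List.map_id vs]
    exact List.map_congr_left fun v hv => ih v hv δ
  | @hlThunk Γ Δ x e τ₁ τ₂ σ d hσ _ _ ih₁ ih₂ =>
    intro δ
    have hc := (hσ.closing ih₁ ih₂).update (.hl x) (v := .var (.hl x)) (.inl rfl)
    simp only [Val.msubst, Prog.msubst, Instr.msubst, Prog.msubst_msubst _ _ hc]
    congr 3
    refine d.msubst_congr ⟨fun y hy => ?_, fun y hy => ?_⟩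
    · by_cases hxy : y = x
      · subst hxy
        simp [Val.msubst]
      · obtain ⟨τ, hτ⟩ := Option.ne_none_iff_exists'.1 hy
        simp [hxy, ih₁ y τ (by simpa [HLCtx.extend, hxy] using hτ) _]
    · obtain ⟨τ, hτ⟩ := Option.ne_none_iff_exists'.1 hy
      simp [ih₂ y τ hτ _]
  | @llThunk Γ Δ x e τ₁ τ₂ σ d hσ _ _ ih₁ ih₂ =>
    intro δ
    have hc := (hσ.closing ih₁ ih₂).update (.ll x) (v := .var (.ll x)) (.inl rfl)
    simp only [Val.msubst, Prog.msubst, Instr.msubst, Prog.msubst_msubst _ _ hc]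
    congr 3
    refine d.msubst_congr ⟨fun y hy => ?_, fun y hy => ?_⟩
    · obtain ⟨τ, hτ⟩ := Option.ne_none_iff_exists'.1 hy
      simp [ih₁ y τ hτ _]
    · by_cases hxy : y = x
      · subst hxy
        simp [Val.msubst]
      · obtain ⟨τ, hτ⟩ := Option.ne_none_iff_exists'.1 hy
        simp [hxy, ih₂ y τ (by simpa [LLCtx.extend, hxy] using hτ) _]

/-- `Ψ'` extends the heap typing `Ψ`. -/
def HeapTy.Le (Ψ Ψ' : HeapTy) : Prop := ∀ l a, Ψ l = some a → Ψ' l = some a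

theorem HeapTy.Le.refl (Ψ : HeapTy) : Ψ.Le Ψ := fun _ _ h => h

theorem HeapTy.Le.trans {Ψ Ψ' Ψ'' : HeapTy} (h : Ψ.Le Ψ') (h' : Ψ'.Le Ψ'') : Ψ.Le Ψ'' :=
  fun l a hl => h' l a (h l a hl)

theorem HasTy.mono {Ψ Ψ' : HeapTy} (hle : Ψ.Le Ψ') {v : Val} {a : Ty} (h : HasTy Ψ v a) :
    HasTy Ψ' v a := by
  induction h with
  | num n => exact .num n
  | loc h => exact .loc (hle _ _ h)
  | inl _ ih => exact .inl ih
  | inr _ ih => exact .inr ih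
  | pair _ _ ih₁ ih₂ => exact .pair ih₁ ih₂
  | arr _ ih => exact .arr ih
  | hlThunk d hσ _ _ ih₁ ih₂ => exact .hlThunk d hσ ih₁ ih₂
  | llThunk d hσ _ _ ih₁ ih₂ => exact .llThunk d hσ ih₁ ih₂

/-- A heap conforms to a heap typing. -/
def HeapOk (Ψ : HeapTy) (H : Heap) : Prop :=
  ∀ l a, Ψ l = some a → ∃ v, H.lookup l = some v ∧ HasTy Ψ v a

theorem HeapOk.insert {Ψ : HeapTy} {H : Heap} (hH : HeapOk Ψ H) {l : Loc} {a : Ty} {v : Val}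
    (hl : Ψ l = some a) (hv : HasTy Ψ v a) : HeapOk Ψ (H.insert l v) := by
  intro l' b hb
  by_cases h : l' = l
  · subst h
    rw [hl, Option.some.injEq] at hb
    subst hb
    exact ⟨v, Finmap.lookup_insert H, hv⟩
  · rw [Finmap.lookup_insert_of_ne H h]
    exact hH l' b hb

theorem HeapOk.eq_none {Ψ : HeapTy} {H : Heap} (hH : HeapOk Ψ H) {l : Loc} (hl : l ∉ H) :
    Ψ l = none := by
  by_contra h
  obtain ⟨a, ha⟩ := Option.ne_none_iff_exists'.1 h
  obtain ⟨v, hv, -⟩ := hH l a ha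
  exact hl (Finmap.mem_iff.2 ⟨v, hv⟩)

theorem HeapOk.alloc {Ψ : HeapTy} {H : Heap} (hH : HeapOk Ψ H) {l : Loc} (hl : l ∉ H) {a : Ty}
    {v : Val} (hv : HasTy Ψ v a) :
    Ψ.Le (Function.update Ψ l (some a)) ∧ HeapOk (Function.update Ψ l (some a)) (H.insert l v) := by
  have hle : Ψ.Le (Function.update Ψ l (some a)) := by
    intro l' b hb
    have h : l' ≠ l := by
      rintro rfl
      simp [hH.eq_none hl] at hb
    simpa [h] using hb
  refine ⟨hle, fun l' b hb => ?_⟩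
  by_cases h : l' = l
  · subst h
    rw [Function.update_self, Option.some.injEq] at hb
    subst hb
    exact ⟨v, Finmap.lookup_insert H, hv.mono hle⟩
  · rw [Finmap.lookup_insert_of_ne H h]
    rw [Function.update_of_ne h] at hb
    obtain ⟨w, hw, hw'⟩ := hH l' b hb
    exact ⟨w, hw, hw'.mono hle⟩

/-! ## Safety for a bounded number of steps -/

/-- A configuration that is not stuck, except by a permitted failure or with a single value. -/
def Config.Good (c : Config) : Prop :=
  (∃ c', Step c c') ∨
    (c.prog = [] ∧
      ((∃ ec : ErrCode, (ec = .conv ∨ ec = .idx) ∧ c.stack = .fail ec) ∨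
        ∃ v : Val, v.IsValue ∧ c.stack = .vals [v]))

/-- All configurations reachable in fewer than `k` steps are good. -/
def Safe : ℕ → Config → Prop
  | 0, _ => True
  | k + 1, c => c.Good ∧ ∀ c', Step c c' → Safe k c'

theorem Safe.pred : ∀ {k : ℕ} {c : Config}, Safe (k + 1) c → Safe k c
  | 0, _, _ => trivial
  | _ + 1, _, h => ⟨h.1, fun c' hc => (h.2 c' hc).pred⟩

theorem Safe.mono {j k : ℕ} (hjk : j ≤ k) {c : Config} (h : Safe k c) : Safe j c := by
  induction hjk with
  | refl => exact h
  | step _ ih => exact ih h.pred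

theorem Safe.good_of_steps {c c' : Config} (hs : Steps c c') (h : ∀ k, Safe k c) : c'.Good := by
  induction hs using Relation.ReflTransGen.head_induction_on with
  | refl => exact (h 1).1
  | head hstep _ ih => exact ih fun k => (h (k + 1)).2 _ hstep

theorem safe_succ_of_step {k : ℕ} {c c₀ : Config} (hc : Step c c₀)
    (h : ∀ c', Step c c' → Safe k c') : Safe (k + 1) c :=
  ⟨.inl ⟨c₀, hc⟩, h⟩

theorem safe_push {k : ℕ} {H : Heap} {S : List Val} {v : Val} {P : Prog} (hv : v.IsValue)
    (h : Safe k ⟨H, .vals (v :: S), P⟩) : Safe k ⟨H, .vals S, .push v :: P⟩ := by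
  refine (safe_succ_of_step (.push H S v P hv) fun c' hc => ?_).pred
  cases hc with
  | push => exact h
  | typeErr _ _ _ _ hn => exact absurd ⟨_, rfl⟩ hn

theorem safe_add {k : ℕ} {H : Heap} {S : List Val} {n n' : ℤ} {P : Prog}
    (h : Safe k ⟨H, .vals (.num (n + n') :: S), P⟩) :
    Safe k ⟨H, .vals (.num n :: .num n' :: S), .add :: P⟩ := by
  refine (safe_succ_of_step (.add H S n n' P) fun c' hc => ?_).pred
  cases hc with
  | add => exact h
  | typeErr _ _ _ _ hn => exact absurd ⟨_, _, _, rfl⟩ hn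

theorem safe_less {k : ℕ} {H : Heap} {S : List Val} {n n' : ℤ} {P : Prog}
    (h : Safe k ⟨H, .vals (.num (if n < n' then 0 else 1) :: S), P⟩) :
    Safe k ⟨H, .vals (.num n :: .num n' :: S), .less :: P⟩ := by
  refine (safe_succ_of_step (.less H S n n' P) fun c' hc => ?_).pred
  cases hc with
  | less => exact h
  | typeErr _ _ _ _ hn => exact absurd ⟨_, _, _, rfl⟩ hn

theorem safe_if0 {k : ℕ} {H : Heap} {S : List Val} {n : ℤ} {P₁ P₂ P : Prog}
    (h₁ : n = 0 → Safe k ⟨H, .vals S, P₁ ++ P⟩) (h₂ : n ≠ 0 → Safe k ⟨H, .vals S, P₂ ++ P⟩) :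
    Safe k ⟨H, .vals (.num n :: S), .if0 P₁ P₂ :: P⟩ := by
  refine (safe_succ_of_step (.if0 H S n P₁ P₂ P) fun c' hc => ?_).pred
  cases hc with
  | if0 =>
    by_cases hn : n = 0
    · simpa [hn] using h₁ hn
    · simpa [hn] using h₂ hn
  | typeErr _ _ _ _ hn => exact absurd ⟨_, _, rfl⟩ hn

theorem safe_lam {k : ℕ} {H : Heap} {S : List Val} {v : Val} {x : TVar} {P₁ P : Prog}
    (h : Safe k ⟨H, .vals S, Prog.subst x v P₁ ++ P⟩) :
    Safe k ⟨H, .vals (v :: S), .lam x P₁ :: P⟩ := by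
  refine (safe_succ_of_step (.lam H S v x P₁ P) fun c' hc => ?_).pred
  cases hc with
  | lam => exact h
  | typeErr _ _ _ _ hn => exact absurd ⟨_, _, rfl⟩ hn

theorem safe_call {k : ℕ} {H : Heap} {S : List Val} {P₁ P : Prog}
    (h : Safe k ⟨H, .vals S, P₁ ++ P⟩) :
    Safe (k + 1) ⟨H, .vals (.thunk P₁ :: S), .call :: P⟩ := by
  refine safe_succ_of_step (.call H S P₁ P) fun c' hc => ?_
  cases hc with
  | call => exact h
  | typeErr _ _ _ _ hn => exact absurd ⟨_, _, rfl⟩ hn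

theorem safe_len {k : ℕ} {H : Heap} {S ws : List Val} {P : Prog}
    (h : Safe k ⟨H, .vals (.num (ws.length : ℤ) :: S), P⟩) :
    Safe k ⟨H, .vals (.arr ws :: S), .len :: P⟩ := by
  refine (safe_succ_of_step (.len H S ws P) fun c' hc => ?_).pred
  cases hc with
  | len => exact h
  | typeErr _ _ _ _ hn => exact absurd ⟨_, _, rfl⟩ hn

theorem safe_fail {k : ℕ} {H : Heap} {S : Stack} {c : ErrCode} {P : Prog}
    (hc : c = .conv ∨ c = .idx) : Safe k ⟨H, S, .fail c :: P⟩ := by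
  refine (safe_succ_of_step (.fail H S c P) fun c' hs => ?_).pred
  cases hs with
  | fail =>
    cases k with
    | zero => trivial
    | succ k => exact ⟨.inr ⟨rfl, .inl ⟨c, hc, rfl⟩⟩, fun c' h => nomatch h⟩
  | typeErr _ _ _ _ hn => exact absurd trivial hn

theorem safe_idx {k : ℕ} {H : Heap} {S ws : List Val} {n : ℤ} {P : Prog}
    (h : ∀ i : ℕ, n = i → ∀ v, ws[i]? = some v → Safe k ⟨H, .vals (v :: S), P⟩) :
    Safe k ⟨H, .vals (.num n :: .arr ws :: S), .idx :: P⟩ := by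
  have hstep : ∃ c', Step ⟨H, .vals (.num n :: .arr ws :: S), .idx :: P⟩ c' := by
    by_cases hn : 0 ≤ n ∧ n < (ws.length : ℤ)
    · lift n to ℕ using hn.1
      have hlt : n < ws.length := by exact_mod_cast hn.2
      exact ⟨_, .idx H S ws n ws[n] P (List.getElem?_eq_getElem hlt)⟩
    · exact ⟨_, .idxErr H S ws n P hn⟩
  obtain ⟨c₀, hc₀⟩ := hstep
  refine (safe_succ_of_step hc₀ fun c' hc => ?_).pred
  cases hc with
  | idx _ _ _ i v _ hi => exact h i rfl v hi
  | idxErr => exact safe_fail (.inr rfl)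
  | typeErr _ _ _ _ hn => exact absurd ⟨_, _, _, rfl⟩ hn

theorem safe_alloc {k : ℕ} {H : Heap} {S : List Val} {v : Val} {P : Prog}
    (h : ∀ l, l ∉ H → Safe k ⟨H.insert l v, .vals (.loc l :: S), P⟩) :
    Safe k ⟨H, .vals (v :: S), .alloc :: P⟩ := by
  obtain ⟨l, hl⟩ := Infinite.exists_notMem_finset H.keys
  refine (safe_succ_of_step (.alloc H S v l P (mt Finmap.mem_keys.2 hl)) fun c' hc => ?_).pred
  cases hc with
  | alloc _ _ _ l _ hl => exact h l hl
  | typeErr _ _ _ _ hn => exact absurd ⟨_, _, rfl⟩ hn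

theorem safe_read {k : ℕ} {H : Heap} {S : List Val} {l : Loc} {v : Val} {P : Prog}
    (hl : H.lookup l = some v) (h : Safe k ⟨H, .vals (v :: S), P⟩) :
    Safe k ⟨H, .vals (.loc l :: S), .read :: P⟩ := by
  refine (safe_succ_of_step (.read H S l v P hl) fun c' hc => ?_).pred
  cases hc with
  | read _ _ _ w _ hw =>
    obtain rfl : v = w := Option.some.inj (hl.symm.trans hw)
    exact h
  | typeErr _ _ _ _ hn => exact absurd ⟨_, _, rfl⟩ hn

theorem safe_write {k : ℕ} {H : Heap} {S : List Val} {l : Loc} {v : Val} {P : Prog}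
    (hl : l ∈ H) (h : Safe k ⟨H.insert l v, .vals S, P⟩) :
    Safe k ⟨H, .vals (v :: .loc l :: S), .write :: P⟩ := by
  refine (safe_succ_of_step (.write H S l v P hl) fun c' hc => ?_).pred
  cases hc with
  | write => exact h
  | typeErr _ _ _ _ hn => exact absurd ⟨_, _, _, rfl⟩ hn

theorem safe_swap {k : ℕ} {H : Heap} {S : List Val} {v w : Val} {P : Prog} (hv : v.IsValue)
    (hw : w.IsValue) (hvc : v.Closed) (h : Safe k ⟨H, .vals (w :: v :: S), P⟩) :
    Safe k ⟨H, .vals (v :: w :: S), swap ++ P⟩ := by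
  refine safe_lam ?_
  simp only [Prog.subst, Instr.subst, Val.subst, TVar.aux.injEq, one_ne_zero,
    if_true, if_false]
  refine safe_lam ?_
  simp only [Prog.subst, Instr.subst, Val.subst, if_true, hvc.subst_eq]
  exact safe_push hv (safe_push hw h)

theorem safe_dup {k : ℕ} {H : Heap} {S : List Val} {v : Val} {P : Prog} (hv : v.IsValue)
    (h : Safe k ⟨H, .vals (v :: v :: S), P⟩) : Safe k ⟨H, .vals (v :: S), dup ++ P⟩ := by
  refine safe_lam ?_
  simp only [Prog.subst, Instr.subst, Val.subst, if_true]
  exact safe_push hv (safe_push hv h)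

theorem safe_mkPair {k : ℕ} {H : Heap} {S : List Val} {v w : Val} {P : Prog} (hv : v.IsValue)
    (hw : w.IsValue) (hwc : w.Closed) (h : Safe k ⟨H, .vals (.arr [v, w] :: S), P⟩) :
    Safe k ⟨H, .vals (w :: v :: S), mkPair ++ P⟩ := by
  refine safe_lam ?_
  simp only [Prog.subst, Instr.subst, Val.subst, Val.substList, TVar.aux.injEq, zero_ne_one,
    if_true, if_false]
  refine safe_lam ?_
  simp only [Prog.subst, Instr.subst, Val.subst, Val.substList, if_true, hwc.subst_eq]
  exact safe_push (.arr _ (by simpa using ⟨hv, hw⟩)) h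

theorem subst_bindAux (v : Val) (P : Prog) {n : ℕ} : ∀ {m : ℕ}, m ≤ n →
    Prog.subst (.aux n) v (bindAux m P) = bindAux m (Prog.subst (.aux n) v P)
  | 0, _ => rfl
  | m + 1, h => by
    have hm : m ≠ n := by lia
    simp [bindAux, Prog.subst, Instr.subst, hm, subst_bindAux v P (Nat.le_of_succ_le h)]

/-- The substitution of the elements of a list for the auxiliary variables. -/
def auxSubst (vs : List Val) : TVar → Val
  | .aux i => vs.getD i (.var (.aux i))
  | y => .var y

theorem safe_bindAux {k : ℕ} {H : Heap} {S : List Val} {K : Prog} (vs : List Val) :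
    ∀ P : Prog, (∀ v ∈ vs, v.Closed) →
      Safe k ⟨H, .vals S, Prog.msubst (auxSubst vs) P ++ K⟩ →
      Safe k ⟨H, .vals (vs.reverse ++ S), bindAux vs.length P ++ K⟩ := by
  induction vs using List.reverseRecOn with
  | nil =>
    intro P _ h
    have : auxSubst [] = Val.var := by
      funext x
      cases x <;> simp [auxSubst]
    rw [this, Prog.msubst_var] at h
    exact h
  | append_singleton vs v ih =>
    intro P hvs h
    have hv : v.Closed := hvs v (by simp)
    simp only [List.reverse_append, List.reverse_singleton, List.cons_append,
      List.length_append, List.length_singleton]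
    refine safe_lam ?_
    rw [subst_bindAux v P le_rfl]
    refine ih _ (fun w hw => hvs w (by simp [hw])) ?_
    rw [Prog.subst_eq_msubst, Prog.msubst_msubst _ _
      (Closing.update (fun _ => .inl rfl) _ (.inr hv))]
    convert h using 4
    funext y
    by_cases hy : y = .aux vs.length
    · subst hy
      simp [auxSubst, hv _]
    · rw [Function.update_of_ne hy, Val.msubst]
      cases y with
      | aux i =>
        have hi : i ≠ vs.length := fun h => hy (by rw [h])
        rcases lt_or_gt_of_ne hi with hi | hi
        · simp [auxSubst, List.getElem?_append_left hi]
        · rw [auxSubst, auxSubst, List.getD_eq_default _ _ hi.le,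
            List.getD_eq_default _ _ (by simpa using hi)]
      | hl x => rfl
      | ll x => rfl

theorem safe_mkArr {k : ℕ} {H : Heap} {S : List Val} {K : Prog} {vs : List Val}
    (hv : ∀ v ∈ vs, v.IsValue) (hc : ∀ v ∈ vs, v.Closed)
    (h : Safe k ⟨H, .vals (.arr vs :: S), K⟩) :
    Safe k ⟨H, .vals (vs.reverse ++ S), mkArr vs.length ++ K⟩ := by
  refine safe_bindAux vs _ hc ?_
  simp only [Prog.msubst, Instr.msubst, Val.msubst, Val.msubstList_eq_map, List.map_map]
  have : List.map (Val.msubst (auxSubst vs) ∘ fun i => Val.var (.aux i))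
      (List.range vs.length) = vs := by
    refine List.ext_getElem (by simp) fun i h₁ h₂ => ?_
    simp [auxSubst, Val.msubst, h₂]
  rw [this]
  exact safe_push (.arr _ hv) h

theorem HasTy.eq_num {Ψ : HeapTy} {v : Val} (h : HasTy Ψ v .int) : ∃ n, v = .num n := by
  cases h with
  | num n => exact ⟨n, rfl⟩

theorem HasTy.eq_loc {Ψ : HeapTy} {v : Val} {a : Ty} (h : HasTy Ψ v (.ref a)) :
    ∃ l, v = .loc l ∧ Ψ l = some a := by
  cases h with
  | loc h => exact ⟨_, rfl, h⟩

theorem HasTy.eq_arr {Ψ : HeapTy} {v : Val} {a : Ty} (h : HasTy Ψ v (.arr a)) :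
    ∃ vs, v = .arr vs ∧ ∀ w ∈ vs, HasTy Ψ w a := by
  cases h with
  | arr h => exact ⟨_, rfl, h⟩

theorem HasTy.eq_pair {Ψ : HeapTy} {v : Val} {a b : Ty} (h : HasTy Ψ v (.prod a b)) :
    ∃ v₁ v₂, v = .arr [v₁, v₂] ∧ HasTy Ψ v₁ a ∧ HasTy Ψ v₂ b := by
  cases h with
  | pair h₁ h₂ => exact ⟨_, _, rfl, h₁, h₂⟩

theorem HasTy.eq_inl_or_inr {Ψ : HeapTy} {v : Val} {a b : Ty} (h : HasTy Ψ v (.sum a b)) :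
    ∃ (n : ℤ) (w : Val), v = .arr [.num n, w] ∧ (n = 0 ∧ HasTy Ψ w a ∨ n = 1 ∧ HasTy Ψ w b) := by
  cases h with
  | inl h => exact ⟨_, _, rfl, .inl ⟨rfl, h⟩⟩
  | inr h => exact ⟨_, _, rfl, .inr ⟨rfl, h⟩⟩

/-! ## Glue code -/

theorem safe_push_idx {k : ℕ} {H : Heap} {S ws : List Val} {n : ℤ} {P : Prog}
    (h : ∀ i : ℕ, n = i → ∀ v, ws[i]? = some v → Safe k ⟨H, .vals (v :: S), P⟩) :
    Safe k ⟨H, .vals (.arr ws :: S), .push (.num n) :: .idx :: P⟩ :=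
  safe_push (.num n) (safe_idx h)

theorem safe_fst {k : ℕ} {H : Heap} {S ws : List Val} {v : Val} {P : Prog}
    (h : Safe k ⟨H, .vals (v :: S), P⟩) :
    Safe k ⟨H, .vals (.arr (v :: ws) :: S), .push (.num 0) :: .idx :: P⟩ := by
  refine safe_push_idx fun i hi w hw => ?_
  obtain rfl : i = 0 := by lia
  obtain rfl : v = w := by simpa using hw
  exact h

theorem safe_snd {k : ℕ} {H : Heap} {S ws : List Val} {u v : Val} {P : Prog}
    (h : Safe k ⟨H, .vals (v :: S), P⟩) :
    Safe k ⟨H, .vals (.arr (u :: v :: ws) :: S), .push (.num 1) :: .idx :: P⟩ := by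
  refine safe_push_idx fun i hi w hw => ?_
  obtain rfl : i = 1 := by lia
  obtain rfl : v = w := by simpa using hw
  exact h

/-- The code that splits an array into its first two elements. -/
theorem safe_split {k : ℕ} {H : Heap} {S ws : List Val} {u v : Val} {P : Prog}
    (ha : (Val.arr (u :: v :: ws)).IsValue) (hv : v.IsValue) (hvc : v.Closed)
    (h : Safe k ⟨H, .vals (u :: v :: S), P⟩) :
    Safe k ⟨H, .vals (.arr (u :: v :: ws) :: S),
      dup ++ .push (.num 1) :: .idx :: (swap ++ .push (.num 0) :: .idx :: P)⟩ :=
  safe_dup ha (safe_snd (safe_swap hv ha hvc (safe_fst h)))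

theorem Val.closed_num (n : ℤ) : (Val.num n).Closed := fun _ => by simp [Val.msubst]

/-- The code that checks that an array has at least two elements. -/
theorem safe_check {k : ℕ} {H : Heap} {S vs : List Val} {P : Prog} (hv : (Val.arr vs).IsValue)
    (h : ∀ u w ws, vs = u :: w :: ws → Safe k ⟨H, .vals (.arr vs :: S), P⟩) :
    Safe k ⟨H, .vals (.arr vs :: S),
      dup ++ .len :: .push (.num 2) :: (swap ++ .less :: .if0 [.fail .conv] [] :: P)⟩ := by
  refine safe_dup hv (safe_len (safe_push (.num 2) (safe_swap (.num 2) (.num _)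
    (Val.closed_num 2) (safe_less (safe_if0 (fun _ => safe_fail (.inl rfl)) ?_)))))
  intro hlen
  match vs with
  | [] => simp at hlen
  | [_] => simp at hlen
  | u :: w :: ws => exact h u w ws rfl

theorem Convertible.safe_toLL {k : ℕ} {Ψ : HeapTy} {H : Heap} : ∀ {A : HLTy} {B : LLTy}
    (c : Convertible A B) {S : List Val} {v : Val} {K : Prog}, HasTy Ψ v A.ty →
    (∀ w, HasTy Ψ w B.ty → Safe k ⟨H, .vals (w :: S), K⟩) →
    Safe k ⟨H, .vals (v :: S), c.toLL ++ K⟩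
  | _, _, .bool, _, _, _, hv, h => h _ hv
  | _, _, .refBool, _, _, _, hv, h => h _ hv
  | _, _, .sum c₁ c₂, _, v, _, hv, h => by
    have hval := hv.isValue
    obtain ⟨n, w, rfl, hw⟩ := HasTy.eq_inl_or_inr hv
    have hw' : w.IsValue ∧ w.Closed := by
      rcases hw with ⟨-, hw⟩ | ⟨-, hw⟩ <;> exact ⟨hw.isValue, hw.closed⟩
    simp only [Convertible.toLL, List.append_assoc, List.cons_append, List.nil_append]
    refine safe_split hval hw'.1 hw'.2 (safe_dup (.num n) (safe_if0 (fun hn => ?_) fun hn => ?_))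
    all_goals
      rw [List.append_assoc]
      refine safe_swap (.num n) hw'.1 (Val.closed_num n) ?_
    on_goal 1 => refine c₁.safe_toLL (hw.resolve_right fun h => by lia).2 fun w' hw' => ?_
    on_goal 2 => refine c₂.safe_toLL (hw.resolve_left fun h => hn h.1).2 fun w' hw' => ?_
    all_goals
      refine safe_mkPair (.num n) hw'.isValue hw'.closed (h _ (.arr fun u hu => ?_))
      rcases List.mem_pair.1 hu with rfl | rfl
      exacts [.num n, hw']
  | _, _, .prod c₁ c₂, _, v, _, hv, h => by
    have hval := hv.isValue
    have hcl := hv.closed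
    obtain ⟨v₁, v₂, rfl, h₁, h₂⟩ := HasTy.eq_pair hv
    simp only [Convertible.toLL, List.append_assoc, List.cons_append, List.nil_append]
    refine safe_dup hval (safe_fst (c₁.safe_toLL h₁ fun w₁ hw₁ => ?_))
    refine safe_swap hw₁.isValue hval hw₁.closed (safe_snd (c₂.safe_toLL h₂ fun w₂ hw₂ => ?_))
    refine safe_mkPair hw₁.isValue hw₂.isValue hw₂.closed (h _ (.arr fun u hu => ?_))
    rcases List.mem_pair.1 hu with rfl | rfl
    exacts [hw₁, hw₂]

theorem Convertible.safe_toHL {k : ℕ} {Ψ : HeapTy} {H : Heap} : ∀ {A : HLTy} {B : LLTy}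
    (c : Convertible A B) {S : List Val} {v : Val} {K : Prog}, HasTy Ψ v B.ty →
    (∀ w, HasTy Ψ w A.ty → Safe k ⟨H, .vals (w :: S), K⟩) →
    Safe k ⟨H, .vals (v :: S), c.toHL ++ K⟩
  | _, _, .bool, _, _, _, hv, h => h _ hv
  | _, _, .refBool, _, _, _, hv, h => h _ hv
  | _, _, .sum c₁ c₂, _, v, _, hv, h => by
    have hval := hv.isValue
    obtain ⟨vs, rfl, hvs⟩ := HasTy.eq_arr hv
    simp only [Convertible.toHL, List.append_assoc, List.cons_append, List.nil_append]
    refine safe_check hval fun u w ws hws => ?_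
    subst hws
    obtain ⟨n, rfl⟩ := (hvs u (by simp)).eq_num
    have hw := hvs w (by simp)
    refine safe_split hval hw.isValue hw.closed
      (safe_dup (.num n) (safe_if0 (fun hn => ?_) fun hn => ?_))
    · subst hn
      rw [List.append_assoc]
      refine safe_swap (.num 0) hw.isValue (Val.closed_num 0) (c₁.safe_toHL hw fun w' hw' => ?_)
      exact safe_mkPair (.num 0) hw'.isValue hw'.closed (h _ (.inl hw'))
    · simp only [List.append_assoc, List.cons_append, List.nil_append]
      refine safe_dup (.num n) (safe_push (.num (-1)) (safe_add (safe_if0 (fun hn' => ?_) fun _ =>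
        safe_fail (.inl rfl))))
      obtain rfl : n = 1 := by lia
      rw [List.append_assoc]
      refine safe_swap (.num 1) hw.isValue (Val.closed_num 1) (c₂.safe_toHL hw fun w' hw' => ?_)
      exact safe_mkPair (.num 1) hw'.isValue hw'.closed (h _ (.inr hw'))
  | _, _, .prod c₁ c₂, _, v, _, hv, h => by
    have hval := hv.isValue
    obtain ⟨vs, rfl, hvs⟩ := HasTy.eq_arr hv
    simp only [Convertible.toHL, List.append_assoc, List.cons_append, List.nil_append]
    refine safe_check hval fun v₁ v₂ ws hws => ?_
    subst hws
    refine safe_dup hval (safe_fst (c₁.safe_toHL (hvs v₁ (by simp)) fun w₁ hw₁ => ?_))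
    refine safe_swap hw₁.isValue hval hw₁.closed
      (safe_snd (c₂.safe_toHL (hvs v₂ (by simp)) fun w₂ hw₂ => ?_))
    exact safe_mkPair hw₁.isValue hw₂.isValue hw₂.closed (h _ (.pair hw₁ hw₂))

/-! ## Compiled code -/

/-- A substitution of well-typed values for the variables declared in a pair of environments. -/
structure EnvOk (Ψ : HeapTy) (Γ : HLCtx) (Δ : LLCtx) (σ : TVar → Val) : Prop where
  supported : SupportedOn Γ Δ σ
  hl : ∀ y τ, Γ y = some τ → HasTy Ψ (σ (.hl y)) τ.ty
  ll : ∀ y τ, Δ y = some τ → HasTy Ψ (σ (.ll y)) τ.ty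

theorem EnvOk.closing {Ψ : HeapTy} {Γ : HLCtx} {Δ : LLCtx} {σ : TVar → Val}
    (h : EnvOk Ψ Γ Δ σ) : Closing σ :=
  h.supported.closing (fun y τ hy => (h.hl y τ hy).closed) fun y τ hy => (h.ll y τ hy).closed

theorem EnvOk.mono {Ψ Ψ' : HeapTy} (hle : Ψ.Le Ψ') {Γ : HLCtx} {Δ : LLCtx} {σ : TVar → Val}
    (h : EnvOk Ψ Γ Δ σ) : EnvOk Ψ' Γ Δ σ :=
  ⟨h.supported, fun y τ hy => (h.hl y τ hy).mono hle, fun y τ hy => (h.ll y τ hy).mono hle⟩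

theorem EnvOk.empty (Ψ : HeapTy) : EnvOk Ψ HLCtx.empty LLCtx.empty Val.var :=
  ⟨⟨fun _ _ => rfl, fun _ _ => rfl, fun _ => rfl⟩, nofun, nofun⟩

theorem EnvOk.extendHL {Ψ : HeapTy} {Γ : HLCtx} {Δ : LLCtx} {σ : TVar → Val}
    (h : EnvOk Ψ Γ Δ σ) {x : Name} {τ : HLTy} {v : Val} (hv : HasTy Ψ v τ.ty) :
    EnvOk Ψ (Γ.extend x τ) Δ (Function.update σ (.hl x) v) := by
  refine ⟨⟨fun y hy => ?_, fun y hy => ?_, fun i => ?_⟩, fun y τ' hy => ?_, fun y τ' hy => ?_⟩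
  · have hxy : y ≠ x := by rintro rfl; simp [HLCtx.extend] at hy
    simpa [hxy] using h.supported.hl y (by simpa [HLCtx.extend, hxy] using hy)
  · simpa using h.supported.ll y hy
  · simpa using h.supported.aux i
  · by_cases hxy : y = x
    · subst hxy
      obtain rfl : τ = τ' := by simpa [HLCtx.extend] using hy
      simpa using hv
    · simpa [hxy] using h.hl y τ' (by simpa [HLCtx.extend, hxy] using hy)
  · simpa using h.ll y τ' hy

theorem EnvOk.extendLL {Ψ : HeapTy} {Γ : HLCtx} {Δ : LLCtx} {σ : TVar → Val}
    (h : EnvOk Ψ Γ Δ σ) {x : Name} {τ : LLTy} {v : Val} (hv : HasTy Ψ v τ.ty) :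
    EnvOk Ψ Γ (Δ.extend x τ) (Function.update σ (.ll x) v) := by
  refine ⟨⟨fun y hy => ?_, fun y hy => ?_, fun i => ?_⟩, fun y τ' hy => ?_, fun y τ' hy => ?_⟩
  · simpa using h.supported.hl y hy
  · have hxy : y ≠ x := by rintro rfl; simp [LLCtx.extend] at hy
    simpa [hxy] using h.supported.ll y (by simpa [LLCtx.extend, hxy] using hy)
  · simpa using h.supported.aux i
  · simpa using h.hl y τ' hy
  · by_cases hxy : y = x
    · subst hxy
      obtain rfl : τ = τ' := by simpa [LLCtx.extend] using hy
      simpa using hv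
    · simpa [hxy] using h.ll y τ' (by simpa [LLCtx.extend, hxy] using hy)

/-- A continuation is safe after any well-typed value of type `a`, in any well-typed heap. -/
def SafeCont (k : ℕ) (Ψ : HeapTy) (a : Ty) (S : List Val) (K : Prog) : Prop :=
  ∀ (Ψ' : HeapTy) (H : Heap) (v : Val), Ψ.Le Ψ' → HeapOk Ψ' H → HasTy Ψ' v a →
    Safe k ⟨H, .vals (v :: S), K⟩

theorem SafeCont.weaken {j k : ℕ} {Ψ Ψ' : HeapTy} {a : Ty} {S : List Val} {K : Prog}
    (h : SafeCont k Ψ a S K) (hjk : j ≤ k) (hle : Ψ.Le Ψ') : SafeCont j Ψ' a S K :=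
  fun Ψ'' H v hle' hH hv => (h Ψ'' H v (hle.trans hle') hH hv).mono hjk

/-- A program that is safe for `k` steps if it is followed by a continuation that is safe after a
value of type `a`. -/
def SafeProg (k : ℕ) (Ψ : HeapTy) (P : Prog) (a : Ty) : Prop :=
  ∀ (H : Heap) (S : List Val) (K : Prog), HeapOk Ψ H → SafeCont k Ψ a S K →
    Safe k ⟨H, .vals S, P ++ K⟩

/-- All compiled code is safe for `k` steps. -/
structure CompileSafe (k : ℕ) : Prop where
  hl : ∀ {Δ : LLCtx} {Γ : HLCtx} {e : HLExpr} {τ : HLTy} (d : HLDeriv Δ Γ e τ) {Ψ : HeapTy}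
    {σ : TVar → Val}, EnvOk Ψ Γ Δ σ → SafeProg k Ψ (Prog.msubst σ d.compile) τ.ty
  ll : ∀ {Γ : HLCtx} {Δ : LLCtx} {e : LLExpr} {τ : LLTy} (d : LLDeriv Γ Δ e τ) {Ψ : HeapTy}
    {σ : TVar → Val}, EnvOk Ψ Γ Δ σ → SafeProg k Ψ (Prog.msubst σ d.compile) τ.ty

theorem safe_call_of_hasTy {k : ℕ} (ih : ∀ j < k, CompileSafe j) {Ψ : HeapTy} {f v : Val}
    {a b : Ty} (hf : HasTy Ψ f (.fn a b)) (hv : HasTy Ψ v a) {H : Heap} {S : List Val} {K : Prog}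
    (hH : HeapOk Ψ H) (hK : SafeCont k Ψ b S K) :
    Safe k ⟨H, .vals (f :: v :: S), .call :: K⟩ := by
  match k with
  | 0 => trivial
  | k + 1 =>
    generalize hc : Ty.fn a b = c at hf
    cases hf with
    | hlThunk d hσ h₁ h₂ =>
      have henv := EnvOk.mk hσ h₁ h₂
      cases hc
      refine safe_call (safe_lam ?_)
      rw [Prog.subst_msubst_update henv.closing]
      exact (ih k k.lt_succ_self).hl d (henv.extendHL hv) H S K hH
        (hK.weaken k.le_succ (.refl Ψ))
    | llThunk d hσ h₁ h₂ =>
      have henv := EnvOk.mk hσ h₁ h₂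
      cases hc
      refine safe_call (safe_lam ?_)
      rw [Prog.subst_msubst_update henv.closing]
      exact (ih k k.lt_succ_self).ll d (henv.extendLL hv) H S K hH
        (hK.weaken k.le_succ (.refl Ψ))
    | _ => cases hc

theorem safe_app {k : ℕ} (ih : ∀ j < k, CompileSafe j) {Ψ : HeapTy} {P₁ P₂ : Prog} {a b : Ty}
    (h₁ : SafeProg k Ψ P₁ (.fn a b)) (h₂ : ∀ Ψ', Ψ.Le Ψ' → SafeProg k Ψ' P₂ a) :
    SafeProg k Ψ (P₁ ++ P₂ ++ swap ++ [.call]) b := by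
  intro H S K hH hK
  simp only [List.append_assoc, List.cons_append, List.nil_append]
  refine h₁ H S _ hH fun Ψ₁ H₁ f hle₁ hH₁ hf => ?_
  refine h₂ Ψ₁ hle₁ H₁ _ _ hH₁ fun Ψ₂ H₂ v hle₂ hH₂ hv => ?_
  have hf := hf.mono hle₂
  exact safe_swap hv.isValue hf.isValue hv.closed
    (safe_call_of_hasTy ih hf hv hH₂ (hK.weaken le_rfl (hle₁.trans hle₂)))

theorem safe_ref {k : ℕ} {Ψ : HeapTy} {P : Prog} {a : Ty} (h : SafeProg k Ψ P a) :
    SafeProg k Ψ (P ++ [.alloc]) (.ref a) := by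
  intro H S K hH hK
  rw [List.append_assoc]
  refine h H S _ hH fun Ψ' H' v hle hH' hv => safe_alloc fun l hl => ?_
  obtain ⟨hle', hH''⟩ := hH'.alloc hl hv
  exact hK _ _ _ (hle.trans hle') hH'' (.loc (by simp))

theorem safe_deref {k : ℕ} {Ψ : HeapTy} {P : Prog} {a : Ty} (h : SafeProg k Ψ P (.ref a)) :
    SafeProg k Ψ (P ++ [.read]) a := by
  intro H S K hH hK
  rw [List.append_assoc]
  refine h H S _ hH fun Ψ' H' v hle hH' hv => ?_
  obtain ⟨l, rfl, hl⟩ := hv.eq_loc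
  obtain ⟨w, hw, hwt⟩ := hH' l a hl
  exact safe_read hw (hK _ _ _ hle hH' hwt)

theorem safe_assign {k : ℕ} {Ψ : HeapTy} {P₁ P₂ : Prog} {a : Ty}
    (h₁ : SafeProg k Ψ P₁ (.ref a)) (h₂ : ∀ Ψ', Ψ.Le Ψ' → SafeProg k Ψ' P₂ a) :
    SafeProg k Ψ (P₁ ++ P₂ ++ [.write, .push (.num 0)]) .int := by
  intro H S K hH hK
  simp only [List.append_assoc, List.cons_append, List.nil_append]
  refine h₁ H S _ hH fun Ψ₁ H₁ u hle₁ hH₁ hu => ?_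
  refine h₂ Ψ₁ hle₁ H₁ _ _ hH₁ fun Ψ₂ H₂ v hle₂ hH₂ hv => ?_
  obtain ⟨l, rfl, hl⟩ := (hu.mono hle₂).eq_loc
  obtain ⟨w, hw, -⟩ := hH₂ l a hl
  exact safe_write (Finmap.mem_iff.2 ⟨w, hw⟩) (safe_push (.num 0)
    (hK _ _ _ (hle₁.trans hle₂) (hH₂.insert hl hv) (.num 0)))

theorem safe_cond {k : ℕ} {Ψ : HeapTy} {P P₁ P₂ : Prog} {a : Ty} (h : SafeProg k Ψ P .int)
    (h₁ : ∀ Ψ', Ψ.Le Ψ' → SafeProg k Ψ' P₁ a) (h₂ : ∀ Ψ', Ψ.Le Ψ' → SafeProg k Ψ' P₂ a) :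
    SafeProg k Ψ (P ++ [.if0 P₁ P₂]) a := by
  intro H S K hH hK
  rw [List.append_assoc]
  refine h H S _ hH fun Ψ' H' v hle hH' hv => ?_
  obtain ⟨n, rfl⟩ := hv.eq_num
  exact safe_if0 (fun _ => h₁ Ψ' hle _ _ _ hH' (hK.weaken le_rfl hle))
    fun _ => h₂ Ψ' hle _ _ _ hH' (hK.weaken le_rfl hle)

theorem safe_push_value {k : ℕ} {Ψ : HeapTy} {v : Val} {a : Ty} (hv : HasTy Ψ v a) :
    SafeProg k Ψ [.push v] a :=
  fun _ _ _ hH hK => safe_push hv.isValue (hK _ _ _ (.refl Ψ) hH hv)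

theorem safe_tag {k : ℕ} {Ψ : HeapTy} {P : Prog} {a b : Ty} {n : ℤ} (h : SafeProg k Ψ P a)
    (hab : ∀ {Ψ' v}, HasTy Ψ' v a → HasTy Ψ' (.arr [.num n, v]) b) :
    SafeProg k Ψ (P ++ [.lam (.aux 0) [.push (.arr [.num n, .var (.aux 0)])]]) b := by
  intro H S K hH hK
  rw [List.append_assoc]
  refine h H S _ hH fun Ψ' H' v hle hH' hv => safe_lam ?_
  simp only [Prog.subst, Instr.subst, Val.subst, Val.substList, if_true]
  exact safe_push (hab hv).isValue (hK _ _ _ hle hH' (hab hv))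

mutual

theorem HLDeriv.safe_compile {k : ℕ} (ih : ∀ j < k, CompileSafe j) :
    ∀ {Δ : LLCtx} {Γ : HLCtx} {e : HLExpr} {τ : HLTy} (d : HLDeriv Δ Γ e τ) {Ψ : HeapTy}
      {σ : TVar → Val}, EnvOk Ψ Γ Δ σ → SafeProg k Ψ (Prog.msubst σ d.compile) τ.ty
  | _, _, _, _, .unit, _, _, _ => safe_push_value (.num 0)
  | _, _, _, _, .tt, _, _, _ => safe_push_value (.num 0)
  | _, _, _, _, .ff, _, _, _ => safe_push_value (.num 1)
  | _, _, _, _, .var hx, _, _, h => safe_push_value (h.hl _ _ hx)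
  | _, _, _, _, .inl d, _, _, h => by
    simpa [HLDeriv.compile, HLTy.ty, Prog.msubst, Prog.msubst_append, Instr.msubst,
      Val.msubst, Val.msubstList] using safe_tag (d.safe_compile ih h) .inl
  | _, _, _, _, .inr d, _, _, h => by
    simpa [HLDeriv.compile, HLTy.ty, Prog.msubst, Prog.msubst_append, Instr.msubst,
      Val.msubst, Val.msubstList] using safe_tag (d.safe_compile ih h) .inr
  | _, _, _, _, .pair d₁ d₂, _, _, h => by
    intro H S K hH hK
    simp only [HLDeriv.compile, Prog.msubst_append, mkPair_msubst, List.append_assoc]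
    refine d₁.safe_compile ih h H S _ hH fun Ψ₁ H₁ v₁ hle₁ hH₁ hv₁ => ?_
    refine d₂.safe_compile ih (h.mono hle₁) H₁ _ _ hH₁ fun Ψ₂ H₂ v₂ hle₂ hH₂ hv₂ => ?_
    exact safe_mkPair hv₁.isValue hv₂.isValue hv₂.closed
      (hK _ _ _ (hle₁.trans hle₂) hH₂ (.pair (hv₁.mono hle₂) hv₂))
  | _, _, _, _, .fst d, _, _, h => by
    intro H S K hH hK
    simp only [HLDeriv.compile, Prog.msubst, Prog.msubst_append, Instr.msubst, Val.msubst,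
      List.append_assoc]
    refine d.safe_compile ih h H S _ hH fun Ψ₁ H₁ v hle₁ hH₁ hv => ?_
    obtain ⟨v₁, v₂, rfl, h₁, -⟩ := HasTy.eq_pair hv
    exact safe_fst (hK _ _ _ hle₁ hH₁ h₁)
  | _, _, _, _, .snd d, _, _, h => by
    intro H S K hH hK
    simp only [HLDeriv.compile, Prog.msubst, Prog.msubst_append, Instr.msubst, Val.msubst,
      List.append_assoc]
    refine d.safe_compile ih h H S _ hH fun Ψ₁ H₁ v hle₁ hH₁ hv => ?_
    obtain ⟨v₁, v₂, rfl, -, h₂⟩ := HasTy.eq_pair hv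
    exact safe_snd (hK _ _ _ hle₁ hH₁ h₂)
  | _, _, _, _, .ite d d₁ d₂, _, _, h => by
    simpa [HLDeriv.compile, HLTy.ty, Prog.msubst, Prog.msubst_append, Instr.msubst] using
      safe_cond (d.safe_compile ih h) (fun _ hle => d₁.safe_compile ih (h.mono hle))
        fun _ hle => d₂.safe_compile ih (h.mono hle)
  | _, _, _, _, .lam d, _, _, h => by
    simpa [HLDeriv.compile, HLTy.ty, Prog.msubst, Instr.msubst, Val.msubst] using
      safe_push_value (.hlThunk d h.supported h.hl h.ll)
  | _, _, _, _, .app d₁ d₂, _, _, h => by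
    simpa [HLDeriv.compile, HLTy.ty, Prog.msubst, Prog.msubst_append, Instr.msubst,
      swap_msubst] using
      safe_app ih (d₁.safe_compile ih h) fun _ hle => d₂.safe_compile ih (h.mono hle)
  | _, _, _, _, .matchSum d d₁ d₂, _, _, h => by
    intro H S K hH hK
    simp only [HLDeriv.compile, Prog.msubst, Prog.msubst_append, Instr.msubst, Val.msubst,
      swap_msubst, dup_msubst, List.append_assoc, List.cons_append, List.nil_append]
    refine d.safe_compile ih h H S _ hH fun Ψ₁ H₁ v hle₁ hH₁ hv => ?_
    have hval := hv.isValue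
    have h := h.mono hle₁
    obtain ⟨n, w, rfl, hw⟩ := HasTy.eq_inl_or_inr hv
    have hw' : w.IsValue ∧ w.Closed := by
      rcases hw with ⟨-, hw⟩ | ⟨-, hw⟩ <;> exact ⟨hw.isValue, hw.closed⟩
    refine safe_split hval hw'.1 hw'.2 (safe_if0 (fun hn => ?_) fun hn => ?_)
    all_goals
      refine safe_lam ?_
      rw [Prog.subst_msubst_update h.closing]
    · exact d₁.safe_compile ih (h.extendHL (hw.resolve_right fun h => by lia).2) _ _ _ hH₁
        (hK.weaken le_rfl hle₁)
    · exact d₂.safe_compile ih (h.extendHL (hw.resolve_left fun h => hn h.1).2) _ _ _ hH₁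
        (hK.weaken le_rfl hle₁)
  | _, _, _, _, .ref d, _, _, h => by
    simpa [HLDeriv.compile, HLTy.ty, Prog.msubst, Prog.msubst_append, Instr.msubst] using
      safe_ref (d.safe_compile ih h)
  | _, _, _, _, .deref d, _, _, h => by
    simpa [HLDeriv.compile, HLTy.ty, Prog.msubst, Prog.msubst_append, Instr.msubst] using
      safe_deref (d.safe_compile ih h)
  | _, _, _, _, .assign d₁ d₂, _, _, h => by
    simpa [HLDeriv.compile, HLTy.ty, Prog.msubst, Prog.msubst_append, Instr.msubst,
      Val.msubst] using
      safe_assign (d₁.safe_compile ih h) fun _ hle => d₂.safe_compile ih (h.mono hle)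
  | _, _, _, _, .boundary d c, _, _, h => by
    intro H S K hH hK
    simp only [HLDeriv.compile, Prog.msubst_append, c.toHL_msubst, List.append_assoc]
    exact d.safe_compile ih h H S _ hH fun Ψ₁ H₁ v hle₁ hH₁ hv =>
      c.safe_toHL hv fun w hw => hK _ _ _ hle₁ hH₁ hw

theorem LLDeriv.safe_compile {k : ℕ} (ih : ∀ j < k, CompileSafe j) :
    ∀ {Γ : HLCtx} {Δ : LLCtx} {e : LLExpr} {τ : LLTy} (d : LLDeriv Γ Δ e τ) {Ψ : HeapTy}
      {σ : TVar → Val}, EnvOk Ψ Γ Δ σ → SafeProg k Ψ (Prog.msubst σ d.compile) τ.ty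
  | _, _, _, _, .int, _, _, _ => safe_push_value (.num _)
  | _, _, _, _, .var hx, _, _, h => safe_push_value (h.ll _ _ hx)
  | _, _, _, _, .arr ds, _, _, h => by
    intro H S K hH hK
    simp only [LLDeriv.compile, Prog.msubst_append, mkArr_msubst, List.append_assoc]
    refine ds.safe_compile ih h hH fun Ψ₁ H₁ vs hlen hle₁ hH₁ hvs => ?_
    rw [← hlen]
    exact safe_mkArr (fun v hv => (hvs v hv).isValue) (fun v hv => (hvs v hv).closed)
      (hK _ _ _ hle₁ hH₁ (.arr hvs))
  | _, _, _, _, .idx d₁ d₂, _, _, h => by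
    intro H S K hH hK
    simp only [LLDeriv.compile, Prog.msubst, Prog.msubst_append, Instr.msubst, List.append_assoc]
    refine d₁.safe_compile ih h H S _ hH fun Ψ₁ H₁ v₁ hle₁ hH₁ hv₁ => ?_
    refine d₂.safe_compile ih (h.mono hle₁) H₁ _ _ hH₁ fun Ψ₂ H₂ v₂ hle₂ hH₂ hv₂ => ?_
    obtain ⟨vs, rfl, hvs⟩ := HasTy.eq_arr (hv₁.mono hle₂)
    obtain ⟨n, rfl⟩ := HasTy.eq_num hv₂
    exact safe_idx fun i _ v hv =>
      hK _ _ _ (hle₁.trans hle₂) hH₂ (hvs v (List.mem_of_getElem? hv))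
  | _, _, _, _, .lam d, _, _, h => by
    simpa [LLDeriv.compile, LLTy.ty, Prog.msubst, Instr.msubst, Val.msubst] using
      safe_push_value (.llThunk d h.supported h.hl h.ll)
  | _, _, _, _, .app d₁ d₂, _, _, h => by
    simpa [LLDeriv.compile, LLTy.ty, Prog.msubst, Prog.msubst_append, Instr.msubst,
      swap_msubst] using
      safe_app ih (d₁.safe_compile ih h) fun _ hle => d₂.safe_compile ih (h.mono hle)
  | _, _, _, _, .add d₁ d₂, _, _, h => by
    intro H S K hH hK
    simp only [LLDeriv.compile, Prog.msubst, Prog.msubst_append, Instr.msubst, swap_msubst,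
      List.append_assoc]
    refine d₁.safe_compile ih h H S _ hH fun Ψ₁ H₁ v₁ hle₁ hH₁ hv₁ => ?_
    refine d₂.safe_compile ih (h.mono hle₁) H₁ _ _ hH₁ fun Ψ₂ H₂ v₂ hle₂ hH₂ hv₂ => ?_
    obtain ⟨n₁, rfl⟩ := HasTy.eq_num hv₁
    obtain ⟨n₂, rfl⟩ := HasTy.eq_num hv₂
    exact safe_swap (.num n₂) (.num n₁) (Val.closed_num n₂)
      (safe_add (hK _ _ _ (hle₁.trans hle₂) hH₂ (.num _)))
  | _, _, _, _, .if0 d d₁ d₂, _, _, h => by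
    simpa [LLDeriv.compile, LLTy.ty, Prog.msubst, Prog.msubst_append, Instr.msubst] using
      safe_cond (d.safe_compile ih h) (fun _ hle => d₁.safe_compile ih (h.mono hle))
        fun _ hle => d₂.safe_compile ih (h.mono hle)
  | _, _, _, _, .ref d, _, _, h => by
    simpa [LLDeriv.compile, LLTy.ty, Prog.msubst, Prog.msubst_append, Instr.msubst] using
      safe_ref (d.safe_compile ih h)
  | _, _, _, _, .deref d, _, _, h => by
    simpa [LLDeriv.compile, LLTy.ty, Prog.msubst, Prog.msubst_append, Instr.msubst] using
      safe_deref (d.safe_compile ih h)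
  | _, _, _, _, .assign d₁ d₂, _, _, h => by
    simpa [LLDeriv.compile, LLTy.ty, Prog.msubst, Prog.msubst_append, Instr.msubst,
      Val.msubst] using
      safe_assign (d₁.safe_compile ih h) fun _ hle => d₂.safe_compile ih (h.mono hle)
  | _, _, _, _, .boundary d c, _, _, h => by
    intro H S K hH hK
    simp only [LLDeriv.compile, Prog.msubst_append, c.toLL_msubst, List.append_assoc]
    exact d.safe_compile ih h H S _ hH fun Ψ₁ H₁ v hle₁ hH₁ hv =>
      c.safe_toLL hv fun w hw => hK _ _ _ hle₁ hH₁ hw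

theorem LLDerivs.safe_compile {k : ℕ} (ih : ∀ j < k, CompileSafe j) :
    ∀ {Γ : HLCtx} {Δ : LLCtx} {es : List LLExpr} {τ : LLTy} (ds : LLDerivs Γ Δ es τ)
      {Ψ : HeapTy} {σ : TVar → Val}, EnvOk Ψ Γ Δ σ →
      ∀ {H : Heap} {S : List Val} {K : Prog}, HeapOk Ψ H →
      (∀ (Ψ' : HeapTy) (H' : Heap) (vs : List Val), vs.length = es.length → Ψ.Le Ψ' →
        HeapOk Ψ' H' → (∀ v ∈ vs, HasTy Ψ' v τ.ty) →
        Safe k ⟨H', .vals (vs.reverse ++ S), K⟩) →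
      Safe k ⟨H, .vals S, Prog.msubst σ ds.compile ++ K⟩
  | _, _, _, _, .nil, Ψ, _, _, H, _, _, hH, hK => hK Ψ H [] rfl (.refl Ψ) hH (by simp)
  | _, _, _, _, .cons d ds, _, _, h, H, S, _, hH, hK => by
    simp only [LLDerivs.compile, Prog.msubst_append, List.append_assoc]
    refine d.safe_compile ih h H S _ hH fun Ψ₁ H₁ v hle₁ hH₁ hv => ?_
    refine ds.safe_compile ih (h.mono hle₁) hH₁ fun Ψ₂ H₂ vs hlen hle₂ hH₂ hvs => ?_
    have := hK Ψ₂ H₂ (v :: vs) (by simp [hlen]) (hle₁.trans hle₂) hH₂ (by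
      simpa using ⟨hv.mono hle₂, hvs⟩)
    simpa using this

end

theorem compileSafe (k : ℕ) : CompileSafe k := by
  induction k using Nat.strong_induction_on with
  | _ k ih => exact ⟨fun d _ _ h => d.safe_compile ih h, fun d _ _ h => d.safe_compile ih h⟩

/-- Closed compiled RefLL code is safe for any number of steps, from any heap. -/
theorem LLDeriv.safe_of_closed {e : LLExpr} {τ : LLTy}
    (d : LLDeriv HLCtx.empty LLCtx.empty e τ) (H : Heap) (k : ℕ) :
    Safe k ⟨H, .vals [], d.compile⟩ := by
  have := (compileSafe k).ll d (EnvOk.empty fun _ => none) H [] [] (fun _ _ h => nomatch h)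
    fun Ψ' H' v _ _ hv => by
      cases k with
      | zero => trivial
      | succ k => exact ⟨.inr ⟨rfl, .inr ⟨v, hv.isValue, rfl⟩⟩, fun c' h => nomatch h⟩
  rwa [Prog.msubst_var, List.append_nil] at this

end RefInterop

theorem theorem3p3 (e : LLExpr) (τ : LLTy) (d : LLDeriv HLCtx.empty LLCtx.empty e τ)
    (n : ℕ) (W : World n) (H : Heap) (hH : H.Satisfies W)
    (H' : Heap) (S' : Stack) (P' : Prog)
    (hsteps : Steps ⟨H, .vals [], d.compile⟩ ⟨H', S', P'⟩) :
    (∃ (H'' : Heap) (S'' : Stack) (P'' : Prog), Step ⟨H', S', P'⟩ ⟨H'', S'', P''⟩) ∨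
      (P' = [] ∧
        ((∃ c : ErrCode, (c = .conv ∨ c = .idx) ∧ S' = .fail c) ∨
          ∃ v : Val, v.IsValue ∧ S' = .vals [v])) := by
  rcases Safe.good_of_steps hsteps (d.safe_of_closed H) with ⟨c', hc⟩ | h
  · exact .inl ⟨c'.heap, c'.stack, c'.prog, hc⟩
  · exact .inr h
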